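/- **Setting.** Let $d,n\ge 1$, $\alpha>0$, $B,G,G_\infty\ge 1$, and $\mathcal D=\{x\in\mathbb R^d:\|x\|_\infty\le B\}$. In each round $t=1,\dots,n$ a learner plays $x_t$ and then a loss $\ell_t$ is revealed. Each $\ell_t$ is differentiable on $\mathcal D$ and satisfies, for all $x,y\in\mathcal D$, $\|\nabla\ell_t(x)\|_2\le G$, $\|\nabla\ell_t(x)\|_\infty\le G_\infty$, and ($\alpha$-exp-concavity) $$\ell_t(y)\ \ge\ \ell_t(x)+\nabla\ell_t(x)^T(y-x)+\tfrac{\alpha}{2}\bigl(\nabla\ell_t(x)^T(y-x)\bigr)^2 .$$ **Algorithm (FLH-ONS).** Put $$f_t(x)=\Bigl(\sqrt{\alpha/2}\,\nabla\ell_t(x_t)^T(x-x_t)+1/\sqrt{2\alpha}\Bigr)^2,\qquad \gamma=2GB\sqrt{\alpha d/2}+1/\sqrt{2\alpha},$$ $$\zeta=\min\Bigl\{\tfrac1{16GB\sqrt d},\tfrac1{4\gamma^2}\Bigr\},\qquad \eta=\tfrac1{2\gamma^2}.$$ *Base learners.* For $j\ge1$, $E^j$ is Online Newton Step started in round $j$: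 $x_j^{(j)}\in\mathcal D$ is arbitrary, $A_{j-1}^{(j)}=\varepsilon I$ with $\varepsilon=1/(\zeta^2(2B\sqrt d)^2)$, and for $t\ge j$, with $g=\nabla f_t(x_t^{(j)})$, $$A_t^{(j)}=A_{t-1}^{(j)}+gg^T,\qquad x_{t+1}^{(j)}=\operatorname*{argmin}_{x\in\mathcal D}\,(y-x)^TA_t^{(j)}(y-x),\quad y=x_t^{(j)}-\tfrac1\zeta\bigl(A_t^{(j)}\bigr)^{-1}g .$$ *Follow the Leading History.* Start with $v_1^{(1)}=1$. In round $t$ play $x_t=\sum_{j=1}^t v_t^{(j)}x_t^{(j)}$; then set $v_{t+1}^{(t+1)}=\frac1{t+1}$ and, for $i\le t$, $$v_{t+1}^{(i)}=\Bigl(1-\tfrac1{t+1}\Bigr)\frac{v_t^{(i)}e^{-\eta f_t(x_t^{(i)})}}{\sum_{j=1}^t v_t^{(j)}e^{-\eta f_t(x_t^{(j)})}} .$$ **Theorem.** There are absolute constants $K>0$ and $k\in\mathbb N$ such that, for all $d,n,\alpha,B,G,G_\infty$, losses and starting points as above and every real $C_n$, the decisions of FLH-ONS satisfy $x_t\in\mathcal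 D$ for all $t\le n$ (the learner is proper) and, with both suprema over all $w_1,\dots,w_n\in\mathcal D$ with $\sum_{t=2}^n\|w_t-w_{t-1}\|_1\le C_n$, $$\sup_{w}\sum_{t=1}^n\bigl(\ell_t(x_t)-\ell_t(w_t)\bigr)\ \le\ \sup_{w}\sum_{t=1}^n\bigl(f_t(x_t)-f_t(w_t)\bigr)\ =:\ \mathcal R,$$ where $$\mathcal R\le K(1+\log n)^k\,d^2\Bigl(8G^2B^2\alpha d+G^2B^2+\tfrac1\alpha\Bigr)\max\{n^{1/3}C_n^{2/3},1\}\quad\text{if } C_n>1/n,$$ $$\mathcal R\le K(1+\log n)^k\,d\Bigl(8G^2B^2\alpha d+\tfrac1\alpha\Bigr)\quad\text{if } C_n\le 1/n .$$ -/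

import Mathlib

noncomputable section

namespace FLHONS

/-- Points of `ℝ^d`, with the Euclidean norm. -/
abbrev Vec (d : ℕ) : Type := EuclideanSpace ℝ (Fin d)

/-- The box `{x : ‖x‖_∞ ≤ B}`. -/
def box (d : ℕ) (B : ℝ) : Set (Vec d) := {x | ∀ i, |x i| ≤ B}

/-- The gradient of a loss at a point of the box. It is taken within the box, so a loss need only be
differentiable there; for `0 < B` it is the usual gradient whenever the loss is differentiable. -/
def boxGrad {d : ℕ} (B : ℝ) (l : Vec d → ℝ) (x : Vec d) : Vec d :=
  gradientWithin l (box d B) x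

/-- `α`-exp-concavity on the box, in the first-order form. -/
def ExpConcaveOnBox {d : ℕ} (B α : ℝ) (l : Vec d → ℝ) : Prop :=
  ∀ x ∈ box d B, ∀ y ∈ box d B,
    l x + inner ℝ (boxGrad B l x) (y - x) + α / 2 * (inner ℝ (boxGrad B l x) (y - x)) ^ 2 ≤ l y

/-- The quadratic surrogate loss built from a vector `g` (the gradient of the true loss at the
played point `p`): `x ↦ (√(α/2) ⟨g, x - p⟩ + 1/√(2α))²`. -/
def surrogate {d : ℕ} (α : ℝ) (g p : Vec d) (x : Vec d) : ℝ :=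
  (Real.sqrt (α / 2) * inner ℝ g (x - p) + 1 / Real.sqrt (2 * α)) ^ 2

/-! ### Online Newton Step -/

/-- `(y - z)ᵀ A (y - z)`. -/
def quadDist {d : ℕ} (A : Matrix (Fin d) (Fin d) ℝ) (y z : Vec d) : ℝ :=
  (y - z).ofLp ⬝ᵥ (A.mulVec (y - z).ofLp)

/-- The projection of `y` onto `S` in the norm induced by `A`: a minimizer of `quadDist A y` over
`S` (unique when `A` is positive definite and `S` is non-empty, compact and convex). -/
def genProj {d : ℕ} (A : Matrix (Fin d) (Fin d) ℝ) (S : Set (Vec d)) (y : Vec d) : Vec d :=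
  Classical.epsilon fun p => p ∈ S ∧ IsMinOn (quadDist A y) S p

/-- State of Online Newton Step: its current prediction and its current matrix. -/
structure ONSState (d : ℕ) where
  point : Vec d
  mat : Matrix (Fin d) (Fin d) ℝ

/-- Start of ONS with parameter `ζ` on a set of diameter `D`, from the point `z`: the matrix is
`ε I` with `ε = 1 / (ζ² D²)`. -/
def onsInit {d : ℕ} (ζ D : ℝ) (z : Vec d) : ONSState d where
  point := z
  mat := (1 / (ζ ^ 2 * D ^ 2)) • (1 : Matrix (Fin d) (Fin d) ℝ)

/-- The matrix of ONS after receiving the loss `f`: add `∇ ∇ᵀ`, with `∇` the gradient of `f` at the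
current prediction. -/
def onsMat {d : ℕ} (f : Vec d → ℝ) (s : ONSState d) : Matrix (Fin d) (Fin d) ℝ :=
  s.mat + Matrix.vecMulVec (gradient f s.point).ofLp (gradient f s.point).ofLp

/-- One step of ONS with parameter `ζ` and decision set `S`, on the loss `f`. -/
def onsStep {d : ℕ} (ζ : ℝ) (S : Set (Vec d)) (f : Vec d → ℝ) (s : ONSState d) : ONSState d where
  point := genProj (onsMat f s) S
    (s.point - (1 / ζ) • WithLp.toLp 2 ((onsMat f s)⁻¹.mulVec (gradient f s.point).ofLp))
  mat := onsMat f s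

/-! ### Follow the Leading History with ONS base learners on the surrogate losses -/

/-- State of FLH at the start of a round: the weights and the states of the base learners
`1, 2, …`. At the start of round `t`, base learners `1, …, t` are active; the others have weight
`0` and have not been started. -/
structure FLHState (d : ℕ) where
  weight : ℕ → ℝ
  expert : ℕ → ONSState d

/-- The prediction of FLH in round `t`. -/
def flhPredict {d : ℕ} (t : ℕ) (s : FLHState d) : Vec d :=
  ∑ j ∈ Finset.Icc 1 t, s.weight j • (s.expert j).point

/-- The exponential weights update (learning rate `η`, loss `f`) in round `t`. -/
def flhHat {d : ℕ} (η : ℝ) (t : ℕ) (f : Vec d → ℝ) (s : FLHState d) (i : ℕ) : ℝ :=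
  s.weight i * Real.exp (-η * f (s.expert i).point) /
    ∑ j ∈ Finset.Icc 1 t, s.weight j * Real.exp (-η * f (s.expert j).point)

/-- The update of FLH at the end of round `t`, on the loss `f`: base learner `t + 1` enters with
weight `1 / (t + 1)`, and the active base learners make an ONS step. -/
def flhStep {d : ℕ} (η ζ : ℝ) (S : Set (Vec d)) (t : ℕ) (f : Vec d → ℝ) (s : FLHState d) :
    FLHState d where
  weight i :=
    if i = t + 1 then 1 / ((t : ℝ) + 1) else (1 - 1 / ((t : ℝ) + 1)) * flhHat η t f s i
  expert j := if j ≤ t then onsStep ζ S f (s.expert j) else s.expert j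

/-- `γ = 2GB√(αd/2) + 1/√(2α)`. -/
def gam (d : ℕ) (α B G : ℝ) : ℝ :=
  2 * G * B * Real.sqrt (α * d / 2) + 1 / Real.sqrt (2 * α)

/-- The parameter of ONS. -/
def onsParam (d : ℕ) (α B G : ℝ) : ℝ :=
  min (1 / (16 * G * B * Real.sqrt d)) (1 / (4 * gam d α B G ^ 2))

/-- The learning rate of FLH. -/
def flhRate (d : ℕ) (α B G : ℝ) : ℝ := 1 / (2 * gam d α B G ^ 2)

/-- The surrogate of the loss `l` when the point `p` is played. -/
def surrogateAt {d : ℕ} (α B : ℝ) (l : Vec d → ℝ) (p : Vec d) : Vec d → ℝ :=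
  surrogate α (boxGrad B l p) p

/-- `state … k` is the state of FLH-ONS at the end of round `k`, that is, at the start of round
`k + 1`, when the losses are `l 1, l 2, …` and base learner `j` starts from the point `z j`. The
Euclidean diameter of the box is `2B√d`. -/
def state {d : ℕ} (α B G : ℝ) (z : ℕ → Vec d) (l : ℕ → Vec d → ℝ) : ℕ → FLHState d
  | 0 =>
    { weight := fun i => if i = 1 then 1 else 0
      expert := fun j => onsInit (onsParam d α B G) (2 * B * Real.sqrt d) (z j) }
  | k + 1 =>
    flhStep (flhRate d α B G) (onsParam d α B G) (box d B) (k + 1)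
      (surrogateAt α B (l (k + 1)) (flhPredict (k + 1) (state α B G z l k)))
      (state α B G z l k)

/-- The decision of FLH-ONS in round `t ≥ 1`; it depends on `l 1, …, l (t - 1)` only. -/
def decision {d : ℕ} (α B G : ℝ) (z : ℕ → Vec d) (l : ℕ → Vec d → ℝ) (t : ℕ) : Vec d :=
  flhPredict t (state α B G z l (t - 1))

/-- The surrogate loss of round `t ≥ 1` along the run of FLH-ONS. -/
def surrogateLoss {d : ℕ} (α B G : ℝ) (z : ℕ → Vec d) (l : ℕ → Vec d → ℝ) (t : ℕ) :
    Vec d → ℝ :=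
  surrogateAt α B (l t) (decision α B G z l t)

/-! ### Dynamic regret -/

/-- `∑_{t=2}^n ‖w_t - w_{t-1}‖_1`. -/
def totalVariation {d : ℕ} (n : ℕ) (w : ℕ → Vec d) : ℝ :=
  ∑ t ∈ Finset.Icc 2 n, ∑ i, |w t i - w (t - 1) i|

/-- Comparator sequences `w_1, …, w_n` in the box with total variation at most `C`. -/
def comparators (d n : ℕ) (B C : ℝ) : Set (ℕ → Vec d) :=
  {w | (∀ t ∈ Finset.Icc 1 n, w t ∈ box d B) ∧ totalVariation n w ≤ C}

/-- `∑_{t=1}^n (φ_t(x_t) - φ_t(w_t))`. -/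
def dynRegret {d : ℕ} (n : ℕ) (φ : ℕ → Vec d → ℝ) (x w : ℕ → Vec d) : ℝ :=
  ∑ t ∈ Finset.Icc 1 n, (φ t (x t) - φ t (w t))

/-- The supremum, as an extended real, of the dynamic regret over all admissible comparators. -/
def worstRegret {d : ℕ} (n : ℕ) (B C : ℝ) (φ : ℕ → Vec d → ℝ) (x : ℕ → Vec d) : EReal :=
  ⨆ w ∈ comparators d n B C, ((dynRegret n φ x w : ℝ) : EReal)

end FLHONS

end

/-!
The surrogate losses `f_t` are squares of affine functions bounded by `γ` on the box. This gives two
facts about FLH-ONS. A surrogate is exp-concave with the rate of FLH, so the weights of FLH compete,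
on every interval of rounds, with the base learner started at the beginning of the interval
(`flh_regret_le`); and it lies above parabolas in the direction of its gradient, so this base learner
has logarithmic static regret (`ons_regret_le`). Together, on every interval and against every fixed
point of the box, the regret is `O(γ² d log(n+1))` (`interval_regret_le`), hence it is
`O(γ² d log(n+1)) · (1 + number of switches)` against a piecewise constant sequence
(`sum_le_of_interval_regret`).

A comparator `w` of total variation `C` is reduced to a piecewise constant one by randomized rounding
to a grid of mesh `2B/m` (`exists_gridRound_le`). All rounds and all coordinates share one uniform
offset `θ`, and `x` (in units of the mesh) is replaced by `⌊x + θ⌋`, which has mean `x`. Hence the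
first-order change of the loss vanishes on average, whatever `w` is; the second-order change is at
most `γ²/m²` per round; and since `⌊x + θ⌋` is monotone in `x` and integer-valued, the expected number
of switches is at most the total variation in units of the mesh, that is, at most `m C`. Some offset
attains the average, so that
`regret ≤ O(γ² d log(n+1)) (1 + m C) + γ² n / m²` (`dynRegret_surrogate_le`).
The choice `m ≈ (n / C)^(1/3)` balances the terms if `1/n < C ≤ n`, `m = n` suffices if `C ≤ 1/n`, and
for `C > n` the trivial bound is enough. Finally `γ² ≤ 8 G² B² α d + 1/α`. As the first-order term
averages to zero for every `w`, no optimality condition of the comparator is needed.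

The comparison of the true losses with the surrogates is exp-concavity, rearranged
(`loss_sub_le_surrogate_sub`).
-/

namespace FLHONS

/-! ### Randomized rounding of comparators -/

lemma intervalIntegrable_floor_add (x : ℝ) :
    IntervalIntegrable (fun θ : ℝ => (⌊x + θ⌋ : ℝ)) MeasureTheory.volume 0 1 := by
  apply Monotone.intervalIntegrable
  intro a b h
  exact Int.cast_le.2 (Int.floor_le_floor (add_le_add_right h x))

lemma integral_floor_add (x : ℝ) : ∫ θ in (0 : ℝ)..1, (⌊x + θ⌋ : ℝ) = x := by
  have hper : ∫ y in x..x + 1, Int.fract y = 1 / 2 := by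
    rw [Function.Periodic.intervalIntegral_add_eq (Int.fract_periodic ℝ) x 0, zero_add,
      intervalIntegral.integral_congr_ae (g := fun y : ℝ => y)]
    · simp
    · have h1 : ∀ᵐ y : ℝ, y ≠ 1 := by simp [MeasureTheory.ae_iff]
      filter_upwards [h1] with y hy hmem
      rw [Set.uIoc_of_le zero_le_one] at hmem
      exact Int.fract_eq_self.2 ⟨hmem.1.le, lt_of_le_of_ne hmem.2 hy⟩
  have hfl : ∀ a b : ℝ, IntervalIntegrable (fun y : ℝ => (⌊y⌋ : ℝ)) MeasureTheory.volume a b := by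
    intro a b
    apply Monotone.intervalIntegrable
    intro u v h
    exact Int.cast_le.2 (Int.floor_le_floor h)
  have hshift : ∫ θ in (0 : ℝ)..1, (⌊x + θ⌋ : ℝ) = ∫ y in x..x + 1, (⌊y⌋ : ℝ) := by
    simpa using intervalIntegral.integral_comp_add_left (a := 0) (b := 1)
      (fun y : ℝ => (⌊y⌋ : ℝ)) x
  have hid : ∫ y in x..x + 1, (y : ℝ) = x + 1 / 2 := by
    rw [integral_id]; ring
  have hsub : ∫ y in x..x + 1, Int.fract y
      = (∫ y in x..x + 1, (y : ℝ)) - ∫ y in x..x + 1, (⌊y⌋ : ℝ) := by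
    rw [← intervalIntegral.integral_sub intervalIntegral.intervalIntegrable_id (hfl _ _)]
    rfl
  rw [hshift]
  linarith

/-- If an offset in `[0, 1]` is drawn uniformly, then `⌊x + θ⌋` has mean `x`; some offset does at
least as well as the mean in a given linear functional. -/
lemma exists_floor_add_sum_le {ι : Type*} (s : Finset ι) (a x : ι → ℝ) :
    ∃ θ ∈ Set.Ico (0 : ℝ) 1, ∑ i ∈ s, a i * (⌊x i + θ⌋ : ℝ) ≤ ∑ i ∈ s, a i * x i := by
  by_contra! hcon
  have hint : ∀ i ∈ s, IntervalIntegrable (fun θ : ℝ => a i * (⌊x i + θ⌋ : ℝ))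
      MeasureTheory.volume 0 1 := fun i _ => (intervalIntegrable_floor_add (x i)).const_mul _
  have hmean : ∫ θ in (0 : ℝ)..1, ∑ i ∈ s, a i * (⌊x i + θ⌋ : ℝ) = ∑ i ∈ s, a i * x i := by
    rw [intervalIntegral.integral_finsetSum hint]
    refine Finset.sum_congr rfl fun i _ => ?_
    rw [intervalIntegral.integral_const_mul, integral_floor_add]
  have hsum : IntervalIntegrable (fun θ : ℝ => ∑ i ∈ s, a i * (⌊x i + θ⌋ : ℝ))
      MeasureTheory.volume 0 1 := by
    simpa [Finset.sum_fn] using IntervalIntegrable.sum s hint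
  have hpos : 0 < ∫ θ in (0 : ℝ)..1,
      (∑ i ∈ s, a i * (⌊x i + θ⌋ : ℝ) - ∑ i ∈ s, a i * x i) := by
    refine intervalIntegral.intervalIntegral_pos_of_pos_on
      (hsum.sub intervalIntegrable_const) (fun θ hθ => ?_) zero_lt_one
    exact sub_pos.2 (hcon θ ⟨hθ.1.le, hθ.2⟩)
  rw [intervalIntegral.integral_sub hsum intervalIntegrable_const, hmean] at hpos
  simp at hpos

open Classical in
/-- The number of rounds `t ∈ [2, n]` in which the sequence `c` changes. -/
noncomputable def switches {d : ℕ} (n : ℕ) (c : ℕ → Vec d) : ℕ :=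
  ((Finset.Icc 2 n).filter fun t => c t ≠ c (t - 1)).card

/-- Round every coordinate of `x` to the grid of mesh `2B/m` that starts at `-B`. The offset `θ ∈ [0, 1)`
decides which of the two neighbouring grid points is taken. -/
noncomputable def gridRound {d : ℕ} (B : ℝ) (m : ℕ) (θ : ℝ) (x : Vec d) : Vec d :=
  WithLp.toLp 2 fun i => -B + 2 * B / m * (⌊(x i + B) * m / (2 * B) + θ⌋ : ℝ)

lemma gridRound_mem_box {d : ℕ} {B : ℝ} (hB : 0 < B) {m : ℕ} (hm : 0 < m) {θ : ℝ}
    (hθ : θ ∈ Set.Ico (0 : ℝ) 1) {x : Vec d} (hx : x ∈ box d B) :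
    gridRound B m θ x ∈ box d B := by
  intro i
  have hxi := abs_le.1 (hx i)
  have hm' : (0 : ℝ) < m := by exact_mod_cast hm
  set y := (x i + B) * m / (2 * B) with hy
  have hy0 : 0 ≤ y := by
    have : 0 ≤ x i + B := by linarith
    positivity
  have hym : y ≤ m := by
    rw [hy, div_le_iff₀ (by positivity)]
    nlinarith
  have h0 : (0 : ℝ) ≤ (⌊y + θ⌋ : ℝ) := by
    exact_mod_cast Int.floor_nonneg.2 (by linarith [hθ.1])
  have h1 : (⌊y + θ⌋ : ℝ) ≤ m := by
    have : ⌊y + θ⌋ < (m : ℤ) + 1 := by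
      rw [Int.floor_lt]; push_cast; linarith [hθ.2]
    exact_mod_cast Int.lt_add_one_iff.1 this
  have h2 : 2 * B / m * (⌊y + θ⌋ : ℝ) ≤ 2 * B := by
    calc 2 * B / m * (⌊y + θ⌋ : ℝ) ≤ 2 * B / m * m := by gcongr
      _ = 2 * B := by field_simp
  have h3 : 0 ≤ 2 * B / m * (⌊y + θ⌋ : ℝ) := by positivity
  change |-B + 2 * B / m * (⌊y + θ⌋ : ℝ)| ≤ B
  rw [abs_le]
  constructor <;> linarith

lemma gridRound_sub {d : ℕ} {B : ℝ} (hB : 0 < B) {m : ℕ} (hm : 0 < m) (θ : ℝ) (x : Vec d)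
    (i : Fin d) :
    gridRound B m θ x i - x i = 2 * B / m *
      ((⌊(x i + B) * m / (2 * B) + θ⌋ : ℝ) - (x i + B) * m / (2 * B)) := by
  have hm' : (0 : ℝ) < m := by exact_mod_cast hm
  change -B + 2 * B / m * (⌊(x i + B) * m / (2 * B) + θ⌋ : ℝ) - x i = _
  field_simp
  ring

lemma abs_gridRound_sub_le {d : ℕ} {B : ℝ} (hB : 0 < B) {m : ℕ} (hm : 0 < m) {θ : ℝ}
    (hθ : θ ∈ Set.Ico (0 : ℝ) 1) (x : Vec d) (i : Fin d) :
    |gridRound B m θ x i - x i| ≤ 2 * B / m := by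
  have hm' : (0 : ℝ) < m := by exact_mod_cast hm
  rw [gridRound_sub hB hm, abs_mul, abs_of_pos (by positivity : 0 < 2 * B / (m : ℝ))]
  have h1 := Int.floor_le ((x i + B) * m / (2 * B) + θ)
  have h2 := Int.lt_floor_add_one ((x i + B) * m / (2 * B) + θ)
  have : |(⌊(x i + B) * m / (2 * B) + θ⌋ : ℝ) - (x i + B) * m / (2 * B)| ≤ 1 := by
    rw [abs_le]; constructor <;> linarith [hθ.1, hθ.2]
  calc _ ≤ 2 * B / (m : ℝ) * 1 := by gcongr
    _ = _ := mul_one _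

lemma abs_floor_add_sub_floor_add (x y θ : ℝ) :
    |(⌊x + θ⌋ : ℝ) - ⌊y + θ⌋| = (if y ≤ x then 1 else -1) * ((⌊x + θ⌋ : ℝ) - ⌊y + θ⌋) := by
  split_ifs with h
  · have : (⌊y + θ⌋ : ℝ) ≤ ⌊x + θ⌋ := by exact_mod_cast Int.floor_le_floor (by linarith)
    rw [abs_of_nonneg (by linarith)]; ring
  · have : (⌊x + θ⌋ : ℝ) ≤ ⌊y + θ⌋ := by exact_mod_cast Int.floor_le_floor (by linarith)
    rw [abs_of_nonpos (by linarith)]; ring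

/-- A change of the rounded sequence forces an integer-valued coordinate to move by at least one. -/
lemma switches_gridRound_le {d : ℕ} (n : ℕ) (B : ℝ) (m : ℕ) (θ : ℝ) (w : ℕ → Vec d) :
    (switches n fun t => gridRound B m θ (w t) : ℝ) ≤ ∑ t ∈ Finset.Icc 2 n, ∑ i,
      |(⌊(w t i + B) * m / (2 * B) + θ⌋ : ℝ) - ⌊(w (t - 1) i + B) * m / (2 * B) + θ⌋| := by
  classical
  rw [switches, Finset.card_filter, Nat.cast_sum]
  refine Finset.sum_le_sum fun t _ => ?_
  split_ifs with h
  · obtain ⟨i, hi⟩ : ∃ i, ⌊(w t i + B) * m / (2 * B) + θ⌋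
        ≠ ⌊(w (t - 1) i + B) * m / (2 * B) + θ⌋ := by
      by_contra! hall
      exact h (by simp only [gridRound, hall])
    refine le_trans ?_ (Finset.single_le_sum (fun i _ => abs_nonneg _) (Finset.mem_univ i))
    have : 1 ≤ |⌊(w t i + B) * m / (2 * B) + θ⌋ - ⌊(w (t - 1) i + B) * m / (2 * B) + θ⌋| :=
      Int.one_le_abs (sub_ne_zero.2 hi)
    exact_mod_cast this
  · simpa using Finset.sum_nonneg fun i _ => abs_nonneg _

/-- **Rounding with a common random offset.** A sequence `w` in the box is rounded to a grid of
mesh `2B/m`. The mean of the rounded point is the point itself, so a linear functional of the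
rounding error vanishes on average, while the mean number of switches is at most the total
variation in units of the mesh. -/
lemma exists_gridRound_le {d : ℕ} (n : ℕ) {B : ℝ} (hB : 0 < B) {m : ℕ} (hm : 0 < m)
    {W : ℝ} (hW : 0 ≤ W) (p w : ℕ → Vec d) :
    ∃ θ ∈ Set.Ico (0 : ℝ) 1,
      ∑ t ∈ Finset.Icc 1 n, inner ℝ (p t) (gridRound B m θ (w t) - w t)
        + W * switches n (fun t => gridRound B m θ (w t))
        ≤ W * (m / (2 * B) * totalVariation n w) := by
  have hm' : (0 : ℝ) < m := by exact_mod_cast hm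
  set y : ℕ → Fin d → ℝ := fun t i => (w t i + B) * m / (2 * B) with hy
  set σ : ℕ → Fin d → ℝ := fun t i => if y (t - 1) i ≤ y t i then 1 else -1 with hσ
  -- index set: the linear term, and the two halves of the increments
  let s : Finset (((ℕ × Fin d) ⊕ (ℕ × Fin d)) ⊕ (ℕ × Fin d)) :=
    ((Finset.Icc 1 n ×ˢ Finset.univ).disjSum (Finset.Icc 2 n ×ˢ Finset.univ)).disjSum
      (Finset.Icc 2 n ×ˢ Finset.univ)
  obtain ⟨θ, hθ, hle⟩ := exists_floor_add_sum_le s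
    (Sum.elim (Sum.elim (fun q => p q.1 q.2 * (2 * B / m)) (fun q => W * σ q.1 q.2))
      (fun q => -(W * σ q.1 q.2)))
    (Sum.elim (Sum.elim (fun q => y q.1 q.2) (fun q => y q.1 q.2)) (fun q => y (q.1 - 1) q.2))
  refine ⟨θ, hθ, ?_⟩
  simp only [s, Finset.sum_disjSum, Sum.elim_inl, Sum.elim_inr, Finset.sum_product] at hle
  have hlin : ∑ t ∈ Finset.Icc 1 n, inner ℝ (p t) (gridRound B m θ (w t) - w t)
      = ∑ t ∈ Finset.Icc 1 n, ∑ i, p t i * (2 * B / m) * (⌊y t i + θ⌋ : ℝ)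
        - ∑ t ∈ Finset.Icc 1 n, ∑ i, p t i * (2 * B / m) * y t i := by
    rw [← Finset.sum_sub_distrib]
    refine Finset.sum_congr rfl fun t _ => ?_
    rw [← Finset.sum_sub_distrib, PiLp.inner_apply]
    refine Finset.sum_congr rfl fun i _ => ?_
    rw [PiLp.sub_apply, gridRound_sub hB hm]
    simp only [hy, RCLike.inner_apply, conj_trivial]
    ring
  have hsw : W * (switches n fun t => gridRound B m θ (w t) : ℝ)
      ≤ ∑ t ∈ Finset.Icc 2 n, ∑ i, W * σ t i * (⌊y t i + θ⌋ : ℝ)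
        + ∑ t ∈ Finset.Icc 2 n, ∑ i, -(W * σ t i) * (⌊y (t - 1) i + θ⌋ : ℝ) := by
    refine (mul_le_mul_of_nonneg_left (switches_gridRound_le n B m θ w) hW).trans_eq ?_
    rw [← Finset.sum_add_distrib, Finset.mul_sum]
    refine Finset.sum_congr rfl fun t _ => ?_
    rw [← Finset.sum_add_distrib, Finset.mul_sum]
    refine Finset.sum_congr rfl fun i _ => ?_
    rw [abs_floor_add_sub_floor_add]
    simp only [hσ, hy]
    ring
  have htv : W * (m / (2 * B) * totalVariation n w)
      = ∑ t ∈ Finset.Icc 2 n, ∑ i, W * σ t i * y t i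
        + ∑ t ∈ Finset.Icc 2 n, ∑ i, -(W * σ t i) * y (t - 1) i := by
    rw [← Finset.sum_add_distrib, totalVariation, Finset.mul_sum, Finset.mul_sum]
    refine Finset.sum_congr rfl fun t _ => ?_
    rw [← Finset.sum_add_distrib, Finset.mul_sum, Finset.mul_sum]
    refine Finset.sum_congr rfl fun i _ => ?_
    have hdiff : y t i - y (t - 1) i = m / (2 * B) * (w t i - w (t - 1) i) := by
      simp only [hy]; ring
    have habs : σ t i * (y t i - y (t - 1) i) = m / (2 * B) * |w t i - w (t - 1) i| := by
      rw [← abs_of_pos (by positivity : 0 < (m : ℝ) / (2 * B)), ← abs_mul, ← hdiff]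
      simp only [hσ]
      split_ifs with h
      · rw [abs_of_nonneg (by linarith)]; ring
      · rw [abs_of_nonpos (by linarith)]; ring
    rw [← habs]; ring
  linarith

/-! ### Quadratic forms and generalized projections -/

lemma inner_eq_dotProduct {d : ℕ} (x y : Vec d) : inner ℝ x y = x.ofLp ⬝ᵥ y.ofLp := by
  rw [EuclideanSpace.inner_eq_star_dotProduct, star_trivial, dotProduct_comm]

lemma dotProduct_mulVec_symm {d : ℕ} {A : Matrix (Fin d) (Fin d) ℝ} (hA : A.IsHermitian)
    (v w : Fin d → ℝ) : v ⬝ᵥ A.mulVec w = w ⬝ᵥ A.mulVec v := by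
  have hT : A.transpose = A := by simpa [Matrix.IsHermitian] using hA
  rw [Matrix.dotProduct_mulVec, ← Matrix.mulVec_transpose, hT, dotProduct_comm]

lemma quadDist_nonneg {d : ℕ} {A : Matrix (Fin d) (Fin d) ℝ} (hA : A.PosSemidef) (y z : Vec d) :
    0 ≤ quadDist A y z := by
  simpa [quadDist] using hA.dotProduct_mulVec_nonneg (y - z).ofLp

lemma continuous_quadDist {d : ℕ} (A : Matrix (Fin d) (Fin d) ℝ) (y : Vec d) :
    Continuous (quadDist A y) := by
  unfold quadDist
  fun_prop

lemma genProj_spec {d : ℕ} (A : Matrix (Fin d) (Fin d) ℝ) {S : Set (Vec d)} (hS : IsCompact S)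
    (hne : S.Nonempty) (y : Vec d) :
    genProj A S y ∈ S ∧ IsMinOn (quadDist A y) S (genProj A S y) :=
  Classical.epsilon_spec (p := fun p => p ∈ S ∧ IsMinOn (quadDist A y) S p)
    (hS.exists_isMinOn hne (continuous_quadDist A y).continuousOn)

lemma quadDist_add_smul {d : ℕ} {A : Matrix (Fin d) (Fin d) ℝ} (hA : A.IsHermitian)
    (y p v : Vec d) (s : ℝ) :
    quadDist A y (p + s • v) = quadDist A y p - 2 * s * (v.ofLp ⬝ᵥ A.mulVec (y - p).ofLp)
      + s ^ 2 * (v.ofLp ⬝ᵥ A.mulVec v.ofLp) := by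
  have h : (y - (p + s • v)).ofLp = (y - p).ofLp - s • v.ofLp := by
    ext i; simp; ring
  rw [quadDist, quadDist, h, Matrix.mulVec_sub, Matrix.mulVec_smul, sub_dotProduct,
    dotProduct_sub, dotProduct_sub, dotProduct_smul, dotProduct_smul, smul_dotProduct,
    smul_dotProduct, dotProduct_mulVec_symm hA (y - p).ofLp v.ofLp]
  simp only [smul_eq_mul]
  ring

/-- Generalized Pythagorean inequality: projecting onto a convex set brings a point closer to every
element of the set. -/
lemma quadDist_genProj_le {d : ℕ} {A : Matrix (Fin d) (Fin d) ℝ} (hA : A.PosSemidef)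
    {S : Set (Vec d)} (hS : IsCompact S) (hconv : Convex ℝ S) (y : Vec d) {u : Vec d}
    (hu : u ∈ S) : quadDist A (genProj A S y) u ≤ quadDist A y u := by
  obtain ⟨hp, hmin⟩ := genProj_spec A hS ⟨u, hu⟩ y
  set p := genProj A S y
  set v := u - p with hv
  set b := v.ofLp ⬝ᵥ A.mulVec (y - p).ofLp
  set c := v.ofLp ⬝ᵥ A.mulVec v.ofLp with hc
  have hline : ∀ s : ℝ, 0 ≤ s → s ≤ 1 → 0 ≤ s * (s * c - 2 * b) := by
    intro s hs0 hs1
    have hmem : p + s • v ∈ S := by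
      have := hconv.add_smul_sub_mem hp hu ⟨hs0, hs1⟩
      simpa [hv] using this
    have hle := isMinOn_iff.1 hmin _ hmem
    rw [quadDist_add_smul hA.isHermitian] at hle
    linarith
  have hc0 : 0 ≤ c := by
    simpa [hc] using hA.dotProduct_mulVec_nonneg v.ofLp
  have hb : b ≤ 0 := by
    by_contra! hb
    -- a step for which the linear term dominates the quadratic one
    have hs := hline (b / (b + c)) (by positivity) (by rw [div_le_one (by positivity)]; linarith)
    have h1 : b / (b + c) * c - 2 * b < 0 := by
      have : b / (b + c) * c ≤ b := by
        rw [div_mul_eq_mul_div, div_le_iff₀ (by positivity)]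
        nlinarith
      linarith
    exact absurd hs (not_le.2 (mul_neg_of_pos_of_neg (by positivity) h1))
  have hpu : quadDist A p u = c := by
    have h : (p - u).ofLp = -v.ofLp := by ext i; simp [hv]
    rw [quadDist, h, Matrix.mulVec_neg, neg_dotProduct_neg]
  have hyu : quadDist A y u = quadDist A y p - 2 * b + c := by
    have := quadDist_add_smul hA.isHermitian y p v 1
    simpa [hv, b, c] using this
  rw [hpu, hyu]
  linarith [quadDist_nonneg hA y p]

lemma quadDist_newton_step {d : ℕ} {A : Matrix (Fin d) (Fin d) ℝ} (hA : A.PosDef)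
    (x g u : Vec d) (c : ℝ) :
    quadDist A (x - c • WithLp.toLp 2 (A⁻¹.mulVec g.ofLp)) u
      = quadDist A x u - 2 * c * inner ℝ g (x - u)
        + c ^ 2 * (g.ofLp ⬝ᵥ A⁻¹.mulVec g.ofLp) := by
  have h : (x - c • WithLp.toLp 2 (A⁻¹.mulVec g.ofLp) - u).ofLp
      = (x - u).ofLp - c • A⁻¹.mulVec g.ofLp := by
    ext i; simp; ring
  have hinv : A.mulVec (A⁻¹.mulVec g.ofLp) = g.ofLp := by
    rw [Matrix.mulVec_mulVec, Matrix.mul_nonsing_inv _ ((Matrix.isUnit_iff_isUnit_det _).1 hA.isUnit),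
      Matrix.one_mulVec]
  rw [quadDist, quadDist, h, inner_eq_dotProduct, Matrix.mulVec_sub, Matrix.mulVec_smul,
    sub_dotProduct, dotProduct_sub, dotProduct_sub, dotProduct_smul, dotProduct_smul,
    smul_dotProduct, smul_dotProduct, dotProduct_mulVec_symm hA.isHermitian (A⁻¹.mulVec g.ofLp),
    hinv, dotProduct_comm _ g.ofLp, dotProduct_comm _ g.ofLp]
  simp only [smul_eq_mul]
  ring

lemma quadDist_add_vecMulVec {d : ℕ} (A : Matrix (Fin d) (Fin d) ℝ) (g x u : Vec d) :
    quadDist (A + Matrix.vecMulVec g.ofLp g.ofLp) x u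
      = quadDist A x u + inner ℝ g (x - u) ^ 2 := by
  rw [quadDist, quadDist, inner_eq_dotProduct, Matrix.add_mulVec, dotProduct_add,
    Matrix.vecMulVec_mulVec, dotProduct_smul, dotProduct_comm _ g.ofLp]
  simp [sq]

/-! ### Determinant potential of Online Newton Step -/

/-- AM-GM for the eigenvalues, in logarithmic form. -/
lemma log_det_le {d : ℕ} (hd : 0 < d) {A : Matrix (Fin d) (Fin d) ℝ} (hA : A.PosDef) :
    Real.log A.det ≤ d * Real.log (A.trace / d) := by
  have hd' : (0 : ℝ) < d := by exact_mod_cast hd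
  have : Nonempty (Fin d) := ⟨⟨0, hd⟩⟩
  have htr : 0 < A.trace := hA.trace_pos
  set c := A.trace / d with hc
  have hc0 : 0 < c := by positivity
  have hev := hA.eigenvalues_pos
  have hdet : A.det = ∏ i, hA.isHermitian.eigenvalues i := by
    simpa using hA.isHermitian.det_eq_prod_eigenvalues
  have htrace : A.trace = ∑ i, hA.isHermitian.eigenvalues i := by
    simpa using hA.isHermitian.trace_eq_sum_eigenvalues
  rw [hdet, Real.log_prod (fun i _ => (hev i).ne')]
  -- tangent line of the logarithm at the mean eigenvalue
  have hterm : ∀ i, Real.log (hA.isHermitian.eigenvalues i)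
      ≤ hA.isHermitian.eigenvalues i / c - 1 + Real.log c := by
    intro i
    have := Real.log_le_sub_one_of_pos (div_pos (hev i) hc0)
    rw [Real.log_div (hev i).ne' hc0.ne'] at this
    linarith
  refine (Finset.sum_le_sum fun i _ => hterm i).trans_eq ?_
  rw [Finset.sum_add_distrib, Finset.sum_sub_distrib, ← Finset.sum_div, ← htrace]
  simp only [Finset.sum_const, Finset.card_univ, Fintype.card_fin, nsmul_eq_mul, mul_one]
  rw [hc]
  field_simp
  ring

lemma posDef_add_vecMulVec {d : ℕ} {A : Matrix (Fin d) (Fin d) ℝ} (hA : A.PosDef)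
    (g : Fin d → ℝ) : (A + Matrix.vecMulVec g g).PosDef := by
  have := Matrix.posSemidef_vecMulVec_self_star (R := ℝ) g
  rw [star_trivial] at this
  exact hA.add_posSemidef this

/-- A rank-one update `A + g gᵀ` increases `log det` by at least `gᵀ (A + g gᵀ)⁻¹ g`. -/
lemma dotProduct_inv_mulVec_le_log_det {d : ℕ} {A : Matrix (Fin d) (Fin d) ℝ} (hA : A.PosDef)
    (g : Fin d → ℝ) :
    g ⬝ᵥ (A + Matrix.vecMulVec g g)⁻¹.mulVec g
      ≤ Real.log (A + Matrix.vecMulVec g g).det - Real.log A.det := by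
  set A' := A + Matrix.vecMulVec g g with hA'
  have hP : A'.PosDef := posDef_add_vecMulVec hA g
  have hu : IsUnit A'.det := (Matrix.isUnit_iff_isUnit_det _).1 hP.isUnit
  have hdet : A.det = A'.det * (1 - g ⬝ᵥ A'⁻¹.mulVec g) := by
    have h := Matrix.det_add_replicateCol_mul_replicateRow (ι := Unit) hu (-g) g
    have hAA : A' + Matrix.replicateCol Unit (-g) * Matrix.replicateRow Unit g = A := by
      rw [← Matrix.vecMulVec_eq, Matrix.neg_vecMulVec, hA']; abel
    rw [hAA] at h
    rw [h]
    congr 1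
    rw [Matrix.det_unique]
    simp only [Matrix.add_apply, Matrix.one_apply_eq, Matrix.mul_assoc]
    have : (Matrix.replicateRow Unit g * (A'⁻¹ * Matrix.replicateCol Unit (-g))) default default
        = g ⬝ᵥ A'⁻¹.mulVec (-g) := by
      simp [Matrix.mul_apply, dotProduct, Matrix.mulVec]
    rw [this, Matrix.mulVec_neg, dotProduct_neg]
    ring
  have h0 : 0 < 1 - g ⬝ᵥ A'⁻¹.mulVec g := by
    have := hA.det_pos
    rw [hdet] at this
    exact pos_of_mul_pos_right this hP.det_pos.le
  rw [hdet, Real.log_mul hP.det_pos.ne' h0.ne']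
  linarith [Real.log_le_sub_one_of_pos h0]

/-! ### Static regret of Online Newton Step -/

/-- The static regret of Online Newton Step is logarithmic if, along the run, every loss lies above
a parabola of curvature `ζ` in the direction of its gradient and the gradients are at most
`1 / (ζ D)`. Each step decreases the potential `‖x - u‖²_A` by the instantaneous regret, up to a
term `gᵀ A⁻¹ g` which is charged to the growth of `log det A`. -/
lemma ons_regret_le {d : ℕ} (hd : 0 < d) {S : Set (Vec d)} (hS : IsCompact S)
    (hconv : Convex ℝ S) {ζ D L : ℝ} (hζ : 0 < ζ) (hD : 0 < D)
    (hdiam : ∀ x ∈ S, ∀ u ∈ S, ‖x - u‖ ≤ D) (hL : ζ * L * D ≤ 1) (hL0 : 0 ≤ L)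
    (T : ℕ) (f : ℕ → Vec d → ℝ) (s : ℕ → ONSState d) {z : Vec d} (hz : z ∈ S)
    (hs0 : s 0 = onsInit ζ D z) (hstep : ∀ t < T, s (t + 1) = onsStep ζ S (f t) (s t))
    (hgrad : ∀ t < T, ∀ x ∈ S, ‖gradient (f t) x‖ ≤ L)
    (hcurv : ∀ t < T, ∀ x ∈ S, ∀ u ∈ S, f t x - f t u
      ≤ inner ℝ (gradient (f t) x) (x - u) - ζ / 2 * inner ℝ (gradient (f t) x) (x - u) ^ 2)
    {u : Vec d} (hu : u ∈ S) :
    ∑ t ∈ Finset.range T, (f t (s t).point - f t u)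
      ≤ 1 / (2 * ζ) * (1 + d * Real.log (1 + T)) := by
  have hd' : (0 : ℝ) < d := by exact_mod_cast hd
  set ε := 1 / (ζ ^ 2 * D ^ 2) with hε
  have hε0 : 0 < ε := by positivity
  have hL2 : L ^ 2 ≤ ε := by
    rw [hε, le_div_iff₀ (by positivity)]
    calc L ^ 2 * (ζ ^ 2 * D ^ 2) = (ζ * L * D) ^ 2 := by ring
      _ ≤ 1 := pow_le_one₀ (by positivity) hL
  have key : ∀ k ≤ T, (s k).point ∈ S ∧ (s k).mat.PosDef ∧
      (s k).mat.trace ≤ d * ε + k * ε ∧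
      ∑ t ∈ Finset.range k, (f t (s t).point - f t u)
        ≤ ζ / 2 * (ε * D ^ 2 - quadDist (s k).mat (s k).point u)
          + 1 / (2 * ζ) * (Real.log (s k).mat.det - d * Real.log ε) := by
    intro k
    induction k with
    | zero =>
      intro _
      have hdet : Real.log (s 0).mat.det = d * Real.log ε := by
        simp [hs0, onsInit, ← hε]
      refine ⟨by simpa [hs0, onsInit] using hz, ?_, ?_, ?_⟩
      · rw [hs0]
        exact Matrix.PosDef.one.smul hε0
      · simp only [hs0, onsInit, ← hε, Matrix.trace_smul, Matrix.trace_one]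
        simp [mul_comm]
      · rw [hdet]
        have hq : quadDist (s 0).mat (s 0).point u = ε * ‖z - u‖ ^ 2 := by
          rw [← real_inner_self_eq_norm_sq, inner_eq_dotProduct]
          simp only [hs0, onsInit, quadDist, ← hε, Matrix.smul_mulVec, Matrix.one_mulVec,
            dotProduct_smul, smul_eq_mul]
        have hzu := hdiam z hz u hu
        have : ‖z - u‖ ^ 2 ≤ D ^ 2 := by gcongr
        rw [hq]
        simp only [Finset.range_zero, Finset.sum_empty, sub_self, mul_zero, add_zero]
        have h2 : 0 ≤ ε * (D ^ 2 - ‖z - u‖ ^ 2) := mul_nonneg hε0.le (by linarith)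
        have : 0 ≤ ζ / 2 * (ε * D ^ 2 - ε * ‖z - u‖ ^ 2) := by
          rw [← mul_sub]; positivity
        exact this
    | succ k ih =>
      intro hk
      obtain ⟨hmem, hpd, htr, hsum⟩ := ih (by omega)
      have hkT : k < T := by omega
      set g := gradient (f k) (s k).point with hg
      set A' := (s k).mat + Matrix.vecMulVec g.ofLp g.ofLp with hA'
      have hpd' : A'.PosDef := posDef_add_vecMulVec hpd _
      have hmat : (s (k + 1)).mat = A' := by rw [hstep k hkT]; rfl
      have hpt : (s (k + 1)).point = genProj A' S
          ((s k).point - (1 / ζ) • WithLp.toLp 2 (A'⁻¹.mulVec g.ofLp)) := by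
        rw [hstep k hkT]; rfl
      refine ⟨?_, hmat ▸ hpd', ?_, ?_⟩
      · rw [hpt]
        exact (genProj_spec _ hS ⟨u, hu⟩ _).1
      · rw [hmat, hA', Matrix.trace_add, Matrix.trace_vecMulVec, ← inner_eq_dotProduct,
          real_inner_self_eq_norm_sq]
        have : ‖g‖ ^ 2 ≤ L ^ 2 := by
          have := hgrad k hkT _ hmem
          gcongr
        push_cast
        linarith
      · rw [Finset.sum_range_succ, hmat]
        have h1 := hcurv k hkT _ hmem u hu
        have h2 := quadDist_genProj_le hpd'.posSemidef hS hconv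
          ((s k).point - (1 / ζ) • WithLp.toLp 2 (A'⁻¹.mulVec g.ofLp)) hu
        have hrank : quadDist A' (s k).point u
            = quadDist (s k).mat (s k).point u + inner ℝ g ((s k).point - u) ^ 2 :=
          quadDist_add_vecMulVec _ _ _ _
        rw [← hpt, quadDist_newton_step hpd', hrank] at h2
        have h3 := dotProduct_inv_mulVec_le_log_det hpd g.ofLp
        rw [← hA'] at h3
        rw [← hg] at h1
        set q := inner ℝ g ((s k).point - u)
        set r := g.ofLp ⬝ᵥ A'⁻¹.mulVec g.ofLp
        have h4 := mul_le_mul_of_nonneg_left h2 (by positivity : 0 ≤ ζ / 2)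
        have h5 := mul_le_mul_of_nonneg_left h3 (by positivity : 0 ≤ 1 / (2 * ζ))
        have h6 : ζ / 2 * (quadDist (s k).mat (s k).point u + q ^ 2 - 2 * (1 / ζ) * q
            + (1 / ζ) ^ 2 * r)
            = ζ / 2 * quadDist (s k).mat (s k).point u + ζ / 2 * q ^ 2 - q
              + 1 / (2 * ζ) * r := by
          field_simp
        rw [h6] at h4
        linarith
  obtain ⟨-, hpd, htr, hsum⟩ := key T le_rfl
  have hlog : Real.log (s T).mat.det - d * Real.log ε ≤ d * Real.log (1 + T) := by
    have : Nonempty (Fin d) := ⟨⟨0, hd⟩⟩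
    have h1 := log_det_le hd hpd
    have h2 : Real.log ((s T).mat.trace / d) ≤ Real.log (ε * (1 + T)) := by
      apply Real.log_le_log (div_pos hpd.trace_pos hd')
      rw [div_le_iff₀ hd']
      have hd1 : (1 : ℝ) ≤ d := by exact_mod_cast hd
      have : (T : ℝ) * ε ≤ T * ε * d := le_mul_of_one_le_right (by positivity) hd1
      nlinarith
    rw [Real.log_mul hε0.ne' (by positivity)] at h2
    have h3 := mul_le_mul_of_nonneg_left h2 hd'.le
    linarith
  have hq := quadDist_nonneg hpd.posSemidef (s T).point u
  have hεD : ζ / 2 * (ε * D ^ 2) = 1 / (2 * ζ) := by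
    rw [hε]; field_simp
  have h1 := mul_le_mul_of_nonneg_left hlog (by positivity : 0 ≤ 1 / (2 * ζ))
  have h2 : 0 ≤ ζ / 2 * quadDist (s T).mat (s T).point u := by positivity
  linarith

/-! ### The box -/

lemma convex_box (d : ℕ) (B : ℝ) : Convex ℝ (box d B) := by
  intro x hx y hy a b ha hb hab i
  have h1 := abs_le.1 (hx i)
  have h2 := abs_le.1 (hy i)
  simp only [PiLp.add_apply, PiLp.smul_apply, smul_eq_mul]
  rw [abs_le]
  constructor <;> nlinarith

lemma norm_le_of_abs_le {d : ℕ} {x : Vec d} {c : ℝ} (hc : 0 ≤ c) (h : ∀ i, |x i| ≤ c) :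
    ‖x‖ ≤ c * Real.sqrt d := by
  rw [EuclideanSpace.norm_eq, ← Real.sqrt_sq hc, ← Real.sqrt_mul (sq_nonneg c)]
  apply Real.sqrt_le_sqrt
  calc ∑ i, ‖x i‖ ^ 2 ≤ ∑ _i : Fin d, c ^ 2 :=
        Finset.sum_le_sum fun i _ => pow_le_pow_left₀ (norm_nonneg _) (h i) 2
    _ = c ^ 2 * d := by simp [mul_comm]

lemma norm_sub_le_of_mem_box {d : ℕ} {B : ℝ} (hB : 0 ≤ B) {x y : Vec d} (hx : x ∈ box d B)
    (hy : y ∈ box d B) : ‖x - y‖ ≤ 2 * B * Real.sqrt d := by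
  refine norm_le_of_abs_le (by positivity) fun i => ?_
  rw [PiLp.sub_apply]
  linarith [abs_sub (x i) (y i), hx i, hy i]

lemma isCompact_box (d : ℕ) (B : ℝ) : IsCompact (box d B) := by
  apply Metric.isCompact_of_isClosed_isBounded
  · have : box d B = ⋂ i, {x | |x i| ≤ B} := by ext x; simp [box]
    rw [this]
    exact isClosed_iInter fun i => isClosed_le (by fun_prop) continuous_const
  · refine (Metric.isBounded_closedBall (x := (0 : Vec d)) (r := |B| * Real.sqrt d)).subset ?_
    intro x hx
    rw [mem_closedBall_zero_iff]
    exact norm_le_of_abs_le (abs_nonneg B) fun i => (hx i).trans (le_abs_self B)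

/-! ### The parameters -/

lemma gam_pos (d : ℕ) {α B G : ℝ} (hα : 0 < α) (hB : 0 ≤ B) (hG : 0 ≤ G) :
    0 < gam d α B G := by
  unfold gam; positivity

lemma gam_sq_eq (d : ℕ) {α : ℝ} (hα : 0 < α) (B G : ℝ) :
    gam d α B G ^ 2 = 2 * G ^ 2 * B ^ 2 * α * d + 1 / (2 * α) + 2 * G * B * Real.sqrt d := by
  have h1 : Real.sqrt (α * d / 2) ^ 2 = α * d / 2 := Real.sq_sqrt (by positivity)
  have h2 : (1 / Real.sqrt (2 * α)) ^ 2 = 1 / (2 * α) := by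
    rw [div_pow, one_pow, Real.sq_sqrt (by positivity)]
  have h3 : Real.sqrt (α * d / 2) * (1 / Real.sqrt (2 * α)) = Real.sqrt d / 2 := by
    have h4 : α * d / 2 = (2 * α) * (d / 4) := by ring
    have h5 : Real.sqrt ((d : ℝ) / 4) = Real.sqrt d / 2 := by
      rw [Real.sqrt_div' _ (by norm_num : (0 : ℝ) ≤ 4)]
      congr 1
      rw [show (4 : ℝ) = 2 ^ 2 by norm_num, Real.sqrt_sq (by norm_num)]
    have h6 : Real.sqrt (2 * α) ≠ 0 := by positivity
    rw [h4, Real.sqrt_mul (by positivity), h5]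
    field_simp
  rw [gam, add_sq, h2, mul_pow, h1]
  linear_combination 4 * G * B * h3

lemma gam_sq_le (d : ℕ) {α : ℝ} (hα : 0 < α) (B G : ℝ) :
    gam d α B G ^ 2 ≤ 8 * G ^ 2 * B ^ 2 * α * d + 1 / α := by
  have h1 : Real.sqrt (α * d / 2) ^ 2 = α * d / 2 := Real.sq_sqrt (by positivity)
  have h2 : (1 / Real.sqrt (2 * α)) ^ 2 = 1 / (2 * α) := by
    rw [div_pow, one_pow, Real.sq_sqrt (by positivity)]
  have h3 : gam d α B G ^ 2 ≤ 2 * ((2 * G * B * Real.sqrt (α * d / 2)) ^ 2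
      + (1 / Real.sqrt (2 * α)) ^ 2) := by
    unfold gam
    nlinarith [sq_nonneg (2 * G * B * Real.sqrt (α * d / 2) - 1 / Real.sqrt (2 * α))]
  rw [mul_pow, h1, h2] at h3
  have h4 : 2 * (1 / (2 * α)) = 1 / α := by field_simp
  have h5 : 0 ≤ G ^ 2 * B ^ 2 * α * d := by positivity
  linarith

/-- The minimum that defines the parameter of the base learners is attained by its second entry,
as `γ² ≥ 4 G B √d` by AM-GM. -/
lemma onsParam_eq {d : ℕ} (hd : 0 < d) {α B G : ℝ} (hα : 0 < α) (hB : 0 < B) (hG : 0 < G) :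
    onsParam d α B G = 1 / (4 * gam d α B G ^ 2) := by
  have hd' : (0 : ℝ) < d := by exact_mod_cast hd
  apply min_eq_right
  apply one_div_le_one_div_of_le (by positivity)
  have : gam d α B G ^ 2 = (2 * G * B * Real.sqrt (α * d / 2) - 1 / Real.sqrt (2 * α)) ^ 2
      + 4 * G * B * Real.sqrt d := by
    have h1 : Real.sqrt (α * d / 2) ^ 2 = α * d / 2 := Real.sq_sqrt (by positivity)
    have h2 : (1 / Real.sqrt (2 * α)) ^ 2 = 1 / (2 * α) := by
      rw [div_pow, one_pow, Real.sq_sqrt (by positivity)]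
    have h3 := gam_sq_eq d hα B G
    have h4 : gam d α B G ^ 2 + (2 * G * B * Real.sqrt (α * d / 2) - 1 / Real.sqrt (2 * α)) ^ 2
        = 2 * ((2 * G * B * Real.sqrt (α * d / 2)) ^ 2 + (1 / Real.sqrt (2 * α)) ^ 2) := by
      unfold gam; ring
    rw [mul_pow, h1, h2] at h4
    linarith
  rw [this]
  nlinarith [sq_nonneg (2 * G * B * Real.sqrt (α * d / 2) - 1 / Real.sqrt (2 * α))]

/-! ### The surrogate losses -/

/-- The affine function whose square is the surrogate loss. -/
noncomputable def surrogateRoot {d : ℕ} (α : ℝ) (g p : Vec d) (x : Vec d) : ℝ :=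
  Real.sqrt (α / 2) * inner ℝ g (x - p) + 1 / Real.sqrt (2 * α)

lemma surrogate_eq_sq {d : ℕ} (α : ℝ) (g p x : Vec d) :
    surrogate α g p x = surrogateRoot α g p x ^ 2 := rfl

lemma surrogateRoot_sub {d : ℕ} (α : ℝ) (g p x y : Vec d) :
    surrogateRoot α g p x - surrogateRoot α g p y = Real.sqrt (α / 2) * inner ℝ g (x - y) := by
  have : x - y = (x - p) - (y - p) := by abel
  rw [this, inner_sub_right, surrogateRoot, surrogateRoot]
  ring

/-- `γ` bounds `√(α/2) ⟨g, x - p⟩ + 1/√(2α)` when `‖g‖ ≤ G` and `x`, `p` lie in the box, whose diameter is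
`2B√d`. -/
lemma gam_eq (d : ℕ) {α : ℝ} (hα : 0 < α) (B G : ℝ) :
    Real.sqrt (α / 2) * (G * (2 * B * Real.sqrt d)) + 1 / Real.sqrt (2 * α)
      = gam d α B G := by
  have : α * d / 2 = α / 2 * d := by ring
  rw [gam, this, Real.sqrt_mul (by positivity : 0 ≤ α / 2)]
  ring

lemma abs_surrogateRoot_le {d : ℕ} {α B G : ℝ} (hα : 0 < α) (hB : 0 ≤ B) (hG : 0 ≤ G)
    {g p x : Vec d} (hg : ‖g‖ ≤ G) (hp : p ∈ box d B) (hx : x ∈ box d B) :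
    |surrogateRoot α g p x| ≤ gam d α B G := by
  rw [← gam_eq d hα, surrogateRoot]
  refine (abs_add_le _ _).trans ?_
  rw [abs_mul, abs_of_nonneg (Real.sqrt_nonneg _),
    abs_of_nonneg (by positivity : 0 ≤ 1 / Real.sqrt (2 * α))]
  have := (abs_real_inner_le_norm g (x - p)).trans
    (mul_le_mul hg (norm_sub_le_of_mem_box hB hx hp) (norm_nonneg _) hG)
  gcongr

lemma surrogate_self {d : ℕ} {α : ℝ} (hα : 0 < α) (g p : Vec d) :
    surrogate α g p p = 1 / (2 * α) := by
  rw [surrogate, sub_self, inner_zero_right, mul_zero, zero_add, div_pow, one_pow,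
    Real.sq_sqrt (by positivity)]

lemma surrogate_eq {d : ℕ} {α : ℝ} (hα : 0 < α) (g p x : Vec d) :
    surrogate α g p x
      = 1 / (2 * α) + inner ℝ g (x - p) + α / 2 * inner ℝ g (x - p) ^ 2 := by
  have h1 : Real.sqrt (α / 2) ^ 2 = α / 2 := Real.sq_sqrt (by positivity)
  have h2 : (1 / Real.sqrt (2 * α)) ^ 2 = 1 / (2 * α) := by
    rw [div_pow, one_pow, Real.sq_sqrt (by positivity)]
  have h3 : Real.sqrt (α / 2) * (1 / Real.sqrt (2 * α)) = 1 / 2 := by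
    have h4 : 2 * α = 2 ^ 2 * (α / 2) := by ring
    have h5 : Real.sqrt (α / 2) ≠ 0 := by positivity
    rw [h4, Real.sqrt_mul (by norm_num), Real.sqrt_sq (by norm_num)]
    field_simp
  rw [surrogate, add_sq, mul_pow, h1, h2]
  linear_combination 2 * inner ℝ g (x - p) * h3

lemma gradient_surrogate {d : ℕ} (α : ℝ) (g p x : Vec d) :
    gradient (surrogate α g p) x
      = (2 * surrogateRoot α g p x * Real.sqrt (α / 2)) • g := by
  apply HasGradientAt.gradient
  rw [hasGradientAt_iff_hasFDerivAt]
  have h1 : HasFDerivAt (fun y : Vec d => inner ℝ g (y - p)) (innerSL ℝ g) x :=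
    (innerSL ℝ g).hasFDerivAt.comp x ((hasFDerivAt_id x).sub_const p)
  have h2 := ((h1.const_mul (Real.sqrt (α / 2))).add_const (1 / Real.sqrt (2 * α))).pow 2
  refine h2.congr_fderiv ?_
  ext y
  simp [surrogateRoot]
  ring

lemma inner_gradient_surrogate {d : ℕ} (α : ℝ) (g p x u : Vec d) :
    inner ℝ (gradient (surrogate α g p) x) (x - u)
      = 2 * surrogateRoot α g p x * (surrogateRoot α g p x - surrogateRoot α g p u) := by
  rw [gradient_surrogate, surrogateRoot_sub, real_inner_smul_left]
  ring

lemma norm_gradient_surrogate_le {d : ℕ} {α B G : ℝ} (hα : 0 < α) (hB : 0 ≤ B) (hG : 0 ≤ G)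
    {g p x : Vec d} (hg : ‖g‖ ≤ G) (hp : p ∈ box d B) (hx : x ∈ box d B) :
    ‖gradient (surrogate α g p) x‖ ≤ 2 * gam d α B G * Real.sqrt (α / 2) * G := by
  rw [gradient_surrogate, norm_smul, Real.norm_eq_abs, abs_mul, abs_mul, abs_two,
    abs_of_nonneg (Real.sqrt_nonneg _)]
  have := abs_surrogateRoot_le hα hB hG hg hp hx
  have := gam_pos d hα hB hG
  gcongr

/-- The square of `s` lies above its tangent at `r` by `(s - r)²`, which is the squared directional
derivative divided by `4 r² ≤ 4 γ²`. -/
lemma surrogate_sub_le {d : ℕ} {α B G : ℝ} (hα : 0 < α) (hB : 0 ≤ B) (hG : 0 ≤ G)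
    {g p x : Vec d} (hg : ‖g‖ ≤ G) (hp : p ∈ box d B) (hx : x ∈ box d B) (u : Vec d) :
    surrogate α g p x - surrogate α g p u
      ≤ inner ℝ (gradient (surrogate α g p) x) (x - u)
        - 1 / (4 * gam d α B G ^ 2) / 2
          * inner ℝ (gradient (surrogate α g p) x) (x - u) ^ 2 := by
  rw [inner_gradient_surrogate, surrogate_eq_sq, surrogate_eq_sq]
  have hγ := gam_pos d hα hB hG
  have hr := abs_surrogateRoot_le hα hB hG hg hp hx
  set r := surrogateRoot α g p x
  set s := surrogateRoot α g p u
  have hr2 : r ^ 2 ≤ gam d α B G ^ 2 := sq_le_sq.2 (by rwa [abs_of_pos hγ])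
  have h1 : 1 / (4 * gam d α B G ^ 2) / 2 * (2 * r * (r - s)) ^ 2
      = (r ^ 2 / gam d α B G ^ 2) * (r - s) ^ 2 / 2 := by
    field_simp
    ring
  have h2 : r ^ 2 / gam d α B G ^ 2 ≤ 1 := (div_le_one (by positivity)).2 hr2
  have h3 := mul_le_mul_of_nonneg_right h2 (sq_nonneg (r - s))
  rw [h1]
  nlinarith [sq_nonneg (r - s)]

lemma loss_sub_le_surrogate_sub {d : ℕ} {α B : ℝ} (hα : 0 < α) {l : Vec d → ℝ}
    (hl : ExpConcaveOnBox B α l) {p w : Vec d} (hp : p ∈ box d B) (hw : w ∈ box d B) :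
    l p - l w ≤ surrogateAt α B l p p - surrogateAt α B l p w := by
  rw [surrogateAt, surrogate_self hα, surrogate_eq hα]
  linarith [hl p hp w hw]

lemma concaveOn_exp_neg_sq {γ : ℝ} (hγ : 0 < γ) :
    ConcaveOn ℝ (Set.Icc (-γ) γ) fun r => Real.exp (-(1 / (2 * γ ^ 2)) * r ^ 2) := by
  set η := 1 / (2 * γ ^ 2) with hη
  have h1 : ∀ r, HasDerivAt (fun r => Real.exp (-η * r ^ 2))
      (-2 * η * r * Real.exp (-η * r ^ 2)) r := by
    intro r
    have := ((hasDerivAt_pow 2 r).const_mul (-η)).exp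
    convert this using 1
    simp; ring
  have h2 : ∀ r, HasDerivAt (fun r => -2 * η * r * Real.exp (-η * r ^ 2))
      ((-2 * η + 4 * η ^ 2 * r ^ 2) * Real.exp (-η * r ^ 2)) r := by
    intro r
    refine (((hasDerivAt_id r).const_mul (-2 * η)).mul (h1 r)).congr_deriv ?_
    simp only [id, mul_one]
    ring
  refine concaveOn_of_hasDerivWithinAt2_nonpos (convex_Icc _ _)
    (Continuous.continuousOn (by fun_prop)) (fun r _ => (h1 r).hasDerivWithinAt)
    (fun r _ => (h2 r).hasDerivWithinAt) fun r hr => ?_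
  rw [interior_Icc] at hr
  apply mul_nonpos_of_nonpos_of_nonneg _ (Real.exp_pos _).le
  have hr2 : r ^ 2 ≤ γ ^ 2 := by nlinarith [hr.1, hr.2]
  have hη0 : 0 < η := by positivity
  have h3 : 2 * η * r ^ 2 ≤ 1 := by
    rw [hη, show 2 * (1 / (2 * γ ^ 2)) * r ^ 2 = r ^ 2 / γ ^ 2 by field_simp]
    exact (div_le_one (by positivity)).2 hr2
  nlinarith

/-- Exp-concavity of the surrogate loss with the rate of FLH. -/
lemma sum_mul_exp_surrogate_le {d : ℕ} {α B G : ℝ} (hα : 0 < α) (hB : 0 ≤ B) (hG : 0 ≤ G)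
    {g p : Vec d} (hg : ‖g‖ ≤ G) (hp : p ∈ box d B) {ι : Type*} (s : Finset ι) {v : ι → ℝ}
    {x : ι → Vec d} (hv : ∀ j ∈ s, 0 ≤ v j) (hsum : ∑ j ∈ s, v j = 1)
    (hx : ∀ j ∈ s, x j ∈ box d B) :
    ∑ j ∈ s, v j * Real.exp (-flhRate d α B G * surrogate α g p (x j))
      ≤ Real.exp (-flhRate d α B G * surrogate α g p (∑ j ∈ s, v j • x j)) := by
  have hγ := gam_pos d hα hB hG
  have hroot : surrogateRoot α g p (∑ j ∈ s, v j • x j)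
      = ∑ j ∈ s, v j • surrogateRoot α g p (x j) := by
    have hlin : ∑ j ∈ s, v j • surrogateRoot α g p (x j)
        = Real.sqrt (α / 2) * ((∑ j ∈ s, v j * inner ℝ g (x j)) - (∑ j ∈ s, v j) * inner ℝ g p)
          + (∑ j ∈ s, v j) * (1 / Real.sqrt (2 * α)) := by
      rw [Finset.sum_mul, Finset.sum_mul, ← Finset.sum_sub_distrib, Finset.mul_sum,
        ← Finset.sum_add_distrib]
      refine Finset.sum_congr rfl fun j _ => ?_
      rw [surrogateRoot, inner_sub_right, smul_eq_mul]
      ring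
    rw [hlin, hsum, surrogateRoot, inner_sub_right, inner_sum]
    simp only [real_inner_smul_right, one_mul]
  rw [surrogate_eq_sq, hroot]
  refine (concaveOn_exp_neg_sq hγ).le_map_sum hv hsum fun j hj => ?_
  exact abs_le.1 (abs_surrogateRoot_le hα hB hG hg hp (hx j hj))

section Run

variable {d : ℕ} {α B G : ℝ} {z : ℕ → Vec d} {l : ℕ → Vec d → ℝ}

/-! ### Follow the Leading History -/

lemma state_succ (k : ℕ) : state α B G z l (k + 1)
    = flhStep (flhRate d α B G) (onsParam d α B G) (box d B) (k + 1)
        (surrogateLoss α B G z l (k + 1)) (state α B G z l k) := rfl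

lemma state_expert_mem_box (hz : ∀ j, z j ∈ box d B) (k j : ℕ) :
    ((state α B G z l k).expert j).point ∈ box d B := by
  induction k with
  | zero => exact hz j
  | succ k ih =>
    rw [state_succ]
    simp only [flhStep]
    split_ifs
    · exact (genProj_spec _ (isCompact_box d B) ⟨_, hz j⟩ _).1
    · exact ih

/-- The total weight before normalization in round `k + 1`. -/
noncomputable def flhNormalizer (η : ℝ) (k : ℕ) (f : Vec d → ℝ) (s : FLHState d) : ℝ :=
  ∑ j ∈ Finset.Icc 1 (k + 1), s.weight j * Real.exp (-η * f (s.expert j).point)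

lemma state_succ_weight_of_le {k i : ℕ} (hi : i ≤ k + 1) :
    (state α B G z l (k + 1)).weight i = (1 - 1 / ((k : ℝ) + 2))
      * ((state α B G z l k).weight i * Real.exp (-flhRate d α B G
          * surrogateLoss α B G z l (k + 1) ((state α B G z l k).expert i).point)
        / flhNormalizer (flhRate d α B G) k (surrogateLoss α B G z l (k + 1))
            (state α B G z l k)) := by
  rw [state_succ]
  simp only [flhStep, flhHat, flhNormalizer]
  rw [if_neg (by omega)]
  push_cast
  ring_nf

lemma state_succ_weight_new (k : ℕ) :
    (state α B G z l (k + 1)).weight (k + 2) = 1 / ((k : ℝ) + 2) := by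
  rw [state_succ]
  simp only [flhStep, if_true]
  push_cast
  ring_nf

lemma one_sub_one_div_pos (k : ℕ) : 0 < 1 - 1 / ((k : ℝ) + 2) := by
  rw [sub_pos, div_lt_one (by positivity)]
  have : (0 : ℝ) ≤ k := k.cast_nonneg
  linarith

lemma state_weight_pos (k : ℕ) : ∀ i ∈ Finset.Icc 1 (k + 1), 0 < (state α B G z l k).weight i := by
  induction k with
  | zero =>
    intro i hi
    have : i = 1 := by rw [Finset.mem_Icc] at hi; omega
    simp [this, state]
  | succ k ih =>
    intro i hi
    rw [Finset.mem_Icc] at hi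
    rcases Nat.lt_or_ge (k + 1) i with h | h
    · obtain rfl : i = k + 2 := by omega
      rw [state_succ_weight_new]
      positivity
    · rw [state_succ_weight_of_le h]
      have h1 := ih i (Finset.mem_Icc.2 ⟨hi.1, h⟩)
      have h2 : 0 < flhNormalizer (flhRate d α B G) k (surrogateLoss α B G z l (k + 1))
          (state α B G z l k) :=
        Finset.sum_pos (fun j hj => mul_pos (ih j hj) (Real.exp_pos _)) ⟨1, by simp⟩
      have h3 := one_sub_one_div_pos k
      positivity

lemma flhNormalizer_pos (η : ℝ) (k : ℕ) (f : Vec d → ℝ) :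
    0 < flhNormalizer η k f (state α B G z l k) :=
  Finset.sum_pos (fun j hj => mul_pos (state_weight_pos k j hj) (Real.exp_pos _)) ⟨1, by simp⟩

lemma sum_state_weight (k : ℕ) :
    ∑ i ∈ Finset.Icc 1 (k + 1), (state α B G z l k).weight i = 1 := by
  cases k with
  | zero => simp [state]
  | succ k =>
    rw [Finset.sum_Icc_succ_top (by omega), state_succ_weight_new,
      Finset.sum_congr rfl fun i hi => state_succ_weight_of_le (Finset.mem_Icc.1 hi).2,
      ← Finset.mul_sum, ← Finset.sum_div]
    change _ * (flhNormalizer _ _ _ _ / flhNormalizer _ _ _ _) + _ = _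
    rw [div_self (flhNormalizer_pos _ k _).ne']
    ring

lemma decision_succ (k : ℕ) : decision α B G z l (k + 1)
    = ∑ j ∈ Finset.Icc 1 (k + 1),
        (state α B G z l k).weight j • ((state α B G z l k).expert j).point := rfl

lemma decision_mem_box (hz : ∀ j, z j ∈ box d B) {t : ℕ} (ht : 1 ≤ t) :
    decision α B G z l t ∈ box d B := by
  obtain ⟨k, rfl⟩ := Nat.exists_eq_add_of_le' ht
  rw [decision_succ]
  exact (convex_box d B).sum_mem (fun i hi => (state_weight_pos k i hi).le)
    (sum_state_weight k) fun i _ => state_expert_mem_box hz k i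

lemma state_expert_init {k j : ℕ} (h : k < j) : (state α B G z l k).expert j
    = onsInit (onsParam d α B G) (2 * B * Real.sqrt d) (z j) := by
  induction k with
  | zero => rfl
  | succ k ih =>
    rw [state_succ]
    simp only [flhStep]
    rw [if_neg (by omega), ih (by omega)]

lemma state_expert_succ {k j : ℕ} (h : j ≤ k + 1) : (state α B G z l (k + 1)).expert j
    = onsStep (onsParam d α B G) (box d B) (surrogateLoss α B G z l (k + 1))
        ((state α B G z l k).expert j) := by
  rw [state_succ]
  simp only [flhStep]
  rw [if_pos h]

/-- By exp-concavity, the weight of a base learner grows by at least the exponential of the regret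
against it; the factor `1 / (k + 1)` collects the initial weight and the later discounts. -/
lemma le_state_weight (hα : 0 < α) (hB : 0 ≤ B) (hG : 0 ≤ G) (hz : ∀ j, z j ∈ box d B)
    {r : ℕ} (k : ℕ) (hk : ∀ t ∈ Finset.Icc (r + 1) k, ∀ x ∈ box d B, ‖boxGrad B (l t) x‖ ≤ G)
    (hr : r ≤ k) :
    1 / ((k : ℝ) + 1) * Real.exp (flhRate d α B G * ∑ t ∈ Finset.Icc (r + 1) k,
        (surrogateLoss α B G z l t (decision α B G z l t)
          - surrogateLoss α B G z l t ((state α B G z l (t - 1)).expert (r + 1)).point))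
      ≤ (state α B G z l k).weight (r + 1) := by
  induction k, hr using Nat.le_induction with
  | base =>
    rw [Finset.Icc_eq_empty (by omega), Finset.sum_empty, mul_zero, Real.exp_zero, mul_one]
    cases r with
    | zero => simp [state]
    | succ r =>
      rw [state_succ_weight_new]
      push_cast
      ring_nf
      exact le_rfl
  | succ k hrk ih =>
    have hmem : k + 1 ∈ Finset.Icc (r + 1) (k + 1) := Finset.mem_Icc.2 ⟨by omega, le_rfl⟩
    have ih' := ih fun t ht => hk t (Finset.Icc_subset_Icc_right (Nat.le_succ k) ht)
    rw [Finset.sum_Icc_succ_top (by omega), state_succ_weight_of_le (by omega)]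
    simp only [Nat.add_sub_cancel]
    set η := flhRate d α B G
    set f := surrogateLoss α B G z l (k + 1) with hf
    set p := decision α B G z l (k + 1) with hp
    set x := ((state α B G z l k).expert (r + 1)).point
    set N := flhNormalizer η k f (state α B G z l k) with hN
    set R := ∑ t ∈ Finset.Icc (r + 1) k,
        (surrogateLoss α B G z l t (decision α B G z l t)
          - surrogateLoss α B G z l t ((state α B G z l (t - 1)).expert (r + 1)).point)
    have hpbox : p ∈ box d B := decision_mem_box hz (Nat.succ_pos k)
    have hNle : N ≤ Real.exp (-η * f p) :=
      sum_mul_exp_surrogate_le hα hB hG (hk _ hmem _ hpbox) hpbox _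
        (fun j hj => (state_weight_pos k j hj).le) (sum_state_weight k)
        fun j _ => state_expert_mem_box hz k j
    have hNpos : 0 < N := flhNormalizer_pos η k f
    have hexp : Real.exp (η * (R + (f p - f x)))
        = Real.exp (η * R) * (Real.exp (-η * f x) / Real.exp (-η * f p)) := by
      rw [← Real.exp_sub, ← Real.exp_add]
      ring_nf
    have hfac : 1 / (((k + 1 : ℕ) : ℝ) + 1) = (1 - 1 / ((k : ℝ) + 2)) * (1 / ((k : ℝ) + 1)) := by
      push_cast
      field_simp
      ring
    have h1 := one_sub_one_div_pos k
    rw [hexp, hfac]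
    calc (1 - 1 / ((k : ℝ) + 2)) * (1 / ((k : ℝ) + 1))
          * (Real.exp (η * R) * (Real.exp (-η * f x) / Real.exp (-η * f p)))
        = (1 - 1 / ((k : ℝ) + 2)) * ((1 / ((k : ℝ) + 1) * Real.exp (η * R))
          * Real.exp (-η * f x) / Real.exp (-η * f p)) := by ring
      _ ≤ (1 - 1 / ((k : ℝ) + 2)) * ((state α B G z l k).weight (r + 1)
          * Real.exp (-η * f x) / N) := by
        have := state_weight_pos (α := α) (B := B) (G := G) (z := z) (l := l) k (r + 1)
          (Finset.mem_Icc.2 ⟨by omega, by omega⟩)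
        gcongr

lemma flh_regret_le (hα : 0 < α) (hB : 0 ≤ B) (hG : 0 ≤ G) (hz : ∀ j, z j ∈ box d B)
    {r k : ℕ} (hk : ∀ t ∈ Finset.Icc (r + 1) k, ∀ x ∈ box d B, ‖boxGrad B (l t) x‖ ≤ G)
    (hr : r ≤ k) :
    ∑ t ∈ Finset.Icc (r + 1) k,
        (surrogateLoss α B G z l t (decision α B G z l t)
          - surrogateLoss α B G z l t ((state α B G z l (t - 1)).expert (r + 1)).point)
      ≤ 2 * gam d α B G ^ 2 * Real.log (1 + k) := by
  have hγ := gam_pos d hα hB hG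
  have h1 := le_state_weight hα hB hG hz k hk hr
  have h2 : (state α B G z l k).weight (r + 1) ≤ 1 := by
    rw [← sum_state_weight (α := α) (B := B) (G := G) (z := z) (l := l) k]
    exact Finset.single_le_sum (fun i hi => (state_weight_pos k i hi).le)
      (Finset.mem_Icc.2 ⟨by omega, by omega⟩)
  set R := ∑ t ∈ Finset.Icc (r + 1) k,
        (surrogateLoss α B G z l t (decision α B G z l t)
          - surrogateLoss α B G z l t ((state α B G z l (t - 1)).expert (r + 1)).point)
  have h3 : Real.exp (flhRate d α B G * R) ≤ 1 + k := by
    have := h1.trans h2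
    rw [one_div_mul_eq_div, div_le_one (by positivity)] at this
    linarith
  have h4 : flhRate d α B G * R ≤ Real.log (1 + k) := by
    rwa [Real.le_log_iff_exp_le (by positivity)]
  rw [flhRate, one_div_mul_eq_div, div_le_iff₀ (by positivity)] at h4
  linarith

/-! ### Adaptive regret -/

/-- Regret on an interval of rounds, against a fixed point: the base learner started at the
beginning of the interval competes with the point, and FLH competes with the base learner. -/
lemma interval_regret_le (hd : 0 < d) (hα : 0 < α) (hB : 0 < B) (hG : 0 < G)
    (hz : ∀ j, z j ∈ box d B) {n r k : ℕ}
    (hl : ∀ t ∈ Finset.Icc 1 n, ∀ x ∈ box d B, ‖boxGrad B (l t) x‖ ≤ G)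
    (hr : r ≤ k) (hkn : k ≤ n) {u : Vec d} (hu : u ∈ box d B) :
    ∑ t ∈ Finset.Icc (r + 1) k,
        (surrogateLoss α B G z l t (decision α B G z l t) - surrogateLoss α B G z l t u)
      ≤ 2 * gam d α B G ^ 2 * (1 + (d + 1) * Real.log (1 + n)) := by
  have hd' : (0 : ℝ) < d := by exact_mod_cast hd
  have hγ := gam_pos d hα hB.le hG.le
  have hmem : ∀ t ∈ Finset.Icc (r + 1) k, t ∈ Finset.Icc 1 n := by
    intro t ht
    rw [Finset.mem_Icc] at ht ⊢
    omega
  have hflh := flh_regret_le hα hB.le hG.le hz (fun t ht => hl t (hmem t ht)) hr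
  have hζ := onsParam_eq hd hα hB hG
  have hround : ∀ i < k - r, r + i + 1 ∈ Finset.Icc 1 n := by
    intro i hi
    rw [Finset.mem_Icc]
    omega
  have hpar : onsParam d α B G * (2 * gam d α B G * Real.sqrt (α / 2) * G)
      * (2 * B * Real.sqrt d) ≤ 1 := by
    have h1 : Real.sqrt (α / 2) * (G * (2 * B * Real.sqrt d)) ≤ gam d α B G := by
      rw [← gam_eq d hα]
      have : 0 ≤ 1 / Real.sqrt (2 * α) := by positivity
      linarith
    rw [hζ]
    calc 1 / (4 * gam d α B G ^ 2) * (2 * gam d α B G * Real.sqrt (α / 2) * G)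
          * (2 * B * Real.sqrt d)
        = Real.sqrt (α / 2) * (G * (2 * B * Real.sqrt d)) / (2 * gam d α B G) := by
          field_simp
          ring
      _ ≤ 1 := by
          rw [div_le_one (by positivity)]
          linarith
  have hons := ons_regret_le hd (isCompact_box d B) (convex_box d B)
    (ζ := onsParam d α B G) (by rw [hζ]; positivity) (by positivity)
    (fun x hx y hy => norm_sub_le_of_mem_box hB.le hx hy) hpar (by positivity) (k - r)
    (fun i => surrogateLoss α B G z l (r + i + 1))
    (fun i => (state α B G z l (r + i)).expert (r + 1)) (hz (r + 1))
    (state_expert_init (Nat.lt_succ_self r)) (fun i _ => state_expert_succ (k := r + i) (by omega))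
    (fun i hi x hx => by
      have hp := decision_mem_box (α := α) (G := G) (l := l) hz (Nat.succ_pos (r + i))
      exact norm_gradient_surrogate_le hα hB.le hG.le (hl _ (hround i hi) _ hp) hp hx)
    (fun i hi x hx y _ => by
      have hp := decision_mem_box (α := α) (G := G) (l := l) hz (Nat.succ_pos (r + i))
      rw [hζ]
      exact surrogate_sub_le hα hB.le hG.le (hl _ (hround i hi) _ hp) hp hx y) hu
  have hreindex : ∑ t ∈ Finset.Icc (r + 1) k,
      (surrogateLoss α B G z l t ((state α B G z l (t - 1)).expert (r + 1)).point
        - surrogateLoss α B G z l t u)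
      = ∑ i ∈ Finset.range (k - r),
        (surrogateLoss α B G z l (r + i + 1) ((state α B G z l (r + i)).expert (r + 1)).point
          - surrogateLoss α B G z l (r + i + 1) u) := by
    rw [← Finset.Ico_add_one_right_eq_Icc, Finset.sum_Ico_eq_sum_range]
    rw [show k + 1 - (r + 1) = k - r by omega]
    refine Finset.sum_congr rfl fun i _ => ?_
    rw [show r + 1 + i = r + i + 1 by ring, Nat.add_sub_cancel]
  have hsplit : ∑ t ∈ Finset.Icc (r + 1) k,
        (surrogateLoss α B G z l t (decision α B G z l t) - surrogateLoss α B G z l t u)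
      = ∑ t ∈ Finset.Icc (r + 1) k,
        (surrogateLoss α B G z l t (decision α B G z l t)
          - surrogateLoss α B G z l t ((state α B G z l (t - 1)).expert (r + 1)).point)
        + ∑ t ∈ Finset.Icc (r + 1) k,
        (surrogateLoss α B G z l t ((state α B G z l (t - 1)).expert (r + 1)).point
          - surrogateLoss α B G z l t u) := by
    rw [← Finset.sum_add_distrib]
    exact Finset.sum_congr rfl fun t _ => by ring
  have hζ2 : 1 / (2 * onsParam d α B G) = 2 * gam d α B G ^ 2 := by
    rw [hζ]
    field_simp
    ring
  have hlog1 : Real.log (1 + ((k - r : ℕ) : ℝ)) ≤ Real.log (1 + n) := by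
    apply Real.log_le_log (by positivity)
    have : ((k - r : ℕ) : ℝ) ≤ n := by exact_mod_cast (Nat.sub_le k r).trans hkn
    linarith
  have hlog2 : Real.log (1 + (k : ℝ)) ≤ Real.log (1 + n) := by
    apply Real.log_le_log (by positivity)
    have : (k : ℝ) ≤ n := by exact_mod_cast hkn
    linarith
  rw [hζ2] at hons
  rw [hsplit, hreindex]
  have h1 := mul_le_mul_of_nonneg_left hlog1 hd'.le
  calc _ ≤ 2 * gam d α B G ^ 2 * Real.log (1 + k)
          + 2 * gam d α B G ^ 2 * (1 + d * Real.log (1 + ((k - r : ℕ) : ℝ))) :=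
        add_le_add hflh hons
    _ = 2 * gam d α B G ^ 2 * (Real.log (1 + k)
          + (1 + d * Real.log (1 + ((k - r : ℕ) : ℝ)))) := by ring
    _ ≤ _ := by
      refine mul_le_mul_of_nonneg_left ?_ (by positivity)
      linarith

end Run

lemma switches_succ_of_eq {d : ℕ} {m : ℕ} {c : ℕ → Vec d} (h : c (m + 1) = c m) :
    switches (m + 1) c = switches m c := by
  classical
  rw [switches, switches]
  rcases Nat.lt_or_ge m 1 with hm | hm
  · rw [Finset.Icc_eq_empty (by omega), Finset.Icc_eq_empty (by omega)]
  · rw [← Finset.insert_Icc_right_eq_Icc_add_one (by omega), Finset.filter_insert,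
      if_neg (by simpa using h)]

lemma switches_succ_of_ne {d : ℕ} {m : ℕ} (hm : 1 ≤ m) {c : ℕ → Vec d} (h : c (m + 1) ≠ c m) :
    switches (m + 1) c = switches m c + 1 := by
  classical
  rw [switches, switches, ← Finset.insert_Icc_right_eq_Icc_add_one (by omega),
    Finset.filter_insert, if_pos (by simpa using h), Finset.card_insert_of_notMem (by simp)]

/-- If the regret on every interval, against every fixed point of `S`, is at most `W`, then the
regret against a sequence in `S` is at most `W` for each of its constant pieces. -/
lemma sum_le_of_interval_regret {d n : ℕ} {S : Set (Vec d)} {W : ℝ} (F : ℕ → Vec d → ℝ)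
    (hF : ∀ r k, r ≤ k → k ≤ n → ∀ u ∈ S, ∑ t ∈ Finset.Icc (r + 1) k, F t u ≤ W)
    (hn : 1 ≤ n) (c : ℕ → Vec d) (hc : ∀ t ∈ Finset.Icc 1 n, c t ∈ S) :
    ∑ t ∈ Finset.Icc 1 n, F t (c t) ≤ W * (1 + switches n c) := by
  -- induction on a point `m` after which `c` is constant, so that the last piece contains `[m, k]`
  have key : ∀ m, 1 ≤ m → ∀ k, m ≤ k → k ≤ n → (∀ t ∈ Finset.Icc m k, c t = c m) →
      ∑ t ∈ Finset.Icc 1 k, F t (c t) ≤ W * (1 + switches m c) := by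
    intro m hm
    induction m, hm using Nat.le_induction with
    | base =>
      intro k hk hkn hconst
      rw [Finset.sum_congr rfl fun t ht => by rw [hconst t ht]]
      have : switches 1 c = 0 := by simp [switches]
      rw [this, Nat.cast_zero, add_zero, mul_one]
      exact hF 0 k (by omega) hkn _ (hc 1 (Finset.mem_Icc.2 ⟨le_rfl, by omega⟩))
    | succ m hm ih =>
      intro k hk hkn hconst
      by_cases hcm : c (m + 1) = c m
      · rw [switches_succ_of_eq hcm]
        refine ih k (by omega) hkn fun t ht => ?_
        rw [Finset.mem_Icc] at ht
        rcases ht.1.eq_or_lt with h | h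
        · rw [h]
        · rw [hconst t (Finset.mem_Icc.2 ⟨h, ht.2⟩), hcm]
      · have h1 := ih m le_rfl (by omega) (fun t ht => by
          rw [Finset.mem_Icc] at ht
          rw [le_antisymm ht.2 ht.1])
        have h2 := hF m k (by omega) hkn _ (hc (m + 1) (Finset.mem_Icc.2 ⟨by omega, by omega⟩))
        have h3 : ∑ t ∈ Finset.Icc 1 k, F t (c t)
            = ∑ t ∈ Finset.Icc 1 m, F t (c t) + ∑ t ∈ Finset.Icc (m + 1) k, F t (c (m + 1)) := by
          have h4 : ∑ t ∈ Finset.Icc (m + 1) k, F t (c (m + 1))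
              = ∑ t ∈ Finset.Icc (m + 1) k, F t (c t) :=
            Finset.sum_congr rfl fun t ht => by rw [hconst t ht]
          rw [h4]
          simp only [← Finset.Ico_add_one_right_eq_Icc]
          exact (Finset.sum_Ico_consecutive (fun t => F t (c t)) (by omega : 1 ≤ m + 1)
            (by omega : m + 1 ≤ k + 1)).symm
        rw [h3, switches_succ_of_ne hm hcm]
        push_cast
        linarith
  exact key n hn n le_rfl le_rfl fun t ht => by
    rw [Finset.mem_Icc] at ht
    rw [le_antisymm ht.2 ht.1]

/-! ### Dynamic regret -/

lemma surrogate_sub_eq {d : ℕ} (α : ℝ) (g p x u : Vec d) :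
    surrogate α g p u - surrogate α g p x
      = inner ℝ (gradient (surrogate α g p) x) (u - x)
        + (Real.sqrt (α / 2) * inner ℝ g (u - x)) ^ 2 := by
  have h1 := inner_gradient_surrogate α g p x u
  have h2 : inner ℝ (gradient (surrogate α g p) x) (u - x)
      = -inner ℝ (gradient (surrogate α g p) x) (x - u) := by
    rw [← inner_neg_right, neg_sub]
  rw [h2, h1, ← surrogateRoot_sub α g p, surrogate_eq_sq, surrogate_eq_sq]
  ring

/-- The rounded comparator has few switches, so the adaptive regret bound applies to it; the price
of rounding is of second order in the mesh, as the first-order term vanishes on average. -/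
lemma dynRegret_surrogate_le {d n : ℕ} {α B G C : ℝ} {z : ℕ → Vec d} {l : ℕ → Vec d → ℝ}
    (hd : 0 < d) (hn : 1 ≤ n) (hα : 0 < α) (hB : 1 ≤ B) (hG : 0 < G) (hz : ∀ j, z j ∈ box d B)
    (hl : ∀ t ∈ Finset.Icc 1 n, ∀ x ∈ box d B, ‖boxGrad B (l t) x‖ ≤ G)
    {w : ℕ → Vec d} (hw : w ∈ comparators d n B C) {m : ℕ} (hm : 0 < m) :
    dynRegret n (surrogateLoss α B G z l) (decision α B G z l) w
      ≤ 2 * gam d α B G ^ 2 * (1 + (d + 1) * Real.log (1 + n)) * (1 + m * C)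
        + gam d α B G ^ 2 * n / (m : ℝ) ^ 2 := by
  have hB0 : 0 < B := by linarith
  have hm' : (0 : ℝ) < m := by exact_mod_cast hm
  have hγ := gam_pos d hα hB0.le hG.le
  set γ := gam d α B G with hγdef
  set W := 2 * γ ^ 2 * (1 + (d + 1) * Real.log (1 + n)) with hW
  have hlog : 0 ≤ Real.log (1 + n) := Real.log_nonneg (by simp)
  have hW0 : 0 ≤ W := by positivity
  set f := surrogateLoss α B G z l
  set x := decision α B G z l
  obtain ⟨θ, hθ, hround⟩ := exists_gridRound_le n hB0 hm hW0 (fun t => gradient (f t) (w t)) w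
  set c : ℕ → Vec d := fun t => gridRound B m θ (w t) with hc
  have hadapt := sum_le_of_interval_regret (n := n) (S := box d B) (W := W)
    (fun t u => f t (x t) - f t u)
    (fun r k hr hk u hu => interval_regret_le hd hα hB0 hG hz hl hr hk hu) hn c
    (fun t ht => gridRound_mem_box hB0 hm hθ (hw.1 t ht))
  have hmove : ∀ t ∈ Finset.Icc 1 n, f t (c t) - f t (w t)
      ≤ inner ℝ (gradient (f t) (w t)) (c t - w t) + γ ^ 2 / (m : ℝ) ^ 2 := by
    intro t ht
    have hx : x t ∈ box d B := decision_mem_box hz (Finset.mem_Icc.1 ht).1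
    have hg : ‖boxGrad B (l t) (x t)‖ ≤ G := hl t ht _ hx
    have h1 : f t (c t) - f t (w t) = _ :=
      surrogate_sub_eq α (boxGrad B (l t) (x t)) (x t) (w t) (c t)
    have hcw : ‖c t - w t‖ ≤ 2 * B / m * Real.sqrt d :=
      norm_le_of_abs_le (by positivity) fun i => abs_gridRound_sub_le hB0 hm hθ (w t) i
    have h2 : |Real.sqrt (α / 2) * inner ℝ (boxGrad B (l t) (x t)) (c t - w t)| ≤ γ / m := by
      rw [abs_mul, abs_of_nonneg (Real.sqrt_nonneg _), le_div_iff₀ hm']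
      have h3 := (abs_real_inner_le_norm (boxGrad B (l t) (x t)) (c t - w t)).trans
        (mul_le_mul hg hcw (norm_nonneg _) hG.le)
      calc _ ≤ Real.sqrt (α / 2) * (G * (2 * B / m * Real.sqrt d)) * m := by gcongr
        _ = Real.sqrt (α / 2) * (G * (2 * B * Real.sqrt d)) := by field_simp
        _ ≤ γ := by
          rw [hγdef, ← gam_eq d hα]
          have : 0 ≤ 1 / Real.sqrt (2 * α) := by positivity
          linarith
    have h3 : (Real.sqrt (α / 2) * inner ℝ (boxGrad B (l t) (x t)) (c t - w t)) ^ 2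
        ≤ γ ^ 2 / (m : ℝ) ^ 2 := by
      rw [← div_pow, ← sq_abs]
      gcongr
    rw [h1]
    exact add_le_add le_rfl h3
  have hsum := Finset.sum_le_sum hmove
  rw [Finset.sum_add_distrib, Finset.sum_const, Nat.card_Icc, Nat.add_sub_cancel,
    nsmul_eq_mul] at hsum
  have hdyn : dynRegret n f x w = ∑ t ∈ Finset.Icc 1 n, (f t (x t) - f t (c t))
      + ∑ t ∈ Finset.Icc 1 n, (f t (c t) - f t (w t)) := by
    rw [dynRegret, ← Finset.sum_add_distrib]
    exact Finset.sum_congr rfl fun t _ => by ring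
  have htv0 : 0 ≤ totalVariation n w :=
    Finset.sum_nonneg fun t _ => Finset.sum_nonneg fun i _ => abs_nonneg _
  have htv : m / (2 * B) * totalVariation n w ≤ m * C := by
    have h1 : (m : ℝ) / (2 * B) ≤ m := div_le_self hm'.le (by linarith)
    exact mul_le_mul h1 hw.2 htv0 hm'.le
  have h4 := mul_le_mul_of_nonneg_left htv hW0
  have h5 : (n : ℝ) * (γ ^ 2 / (m : ℝ) ^ 2) = γ ^ 2 * n / (m : ℝ) ^ 2 := by ring
  rw [h5] at hsum
  rw [hdyn]
  linarith

lemma dynRegret_surrogate_le_trivial {d n : ℕ} {α B G : ℝ} {z : ℕ → Vec d}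
    {l : ℕ → Vec d → ℝ} (hα : 0 < α) (w : ℕ → Vec d) :
    dynRegret n (surrogateLoss α B G z l) (decision α B G z l) w ≤ n * (1 / α) := by
  calc dynRegret n (surrogateLoss α B G z l) (decision α B G z l) w
      ≤ ∑ _t ∈ Finset.Icc 1 n, 1 / α := by
        refine Finset.sum_le_sum fun t _ => ?_
        have h1 : surrogateLoss α B G z l t (decision α B G z l t) = 1 / (2 * α) :=
          surrogate_self hα _ _
        have h2 : 0 ≤ surrogateLoss α B G z l t (w t) := sq_nonneg _
        have h3 : 1 / (2 * α) ≤ 1 / α := one_div_le_one_div_of_le hα (by linarith)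
        linarith
    _ = n * (1 / α) := by simp

lemma adaptive_bound_le {d n : ℕ} (hd : 1 ≤ d) (hn : 1 ≤ n) :
    2 * (1 + ((d : ℝ) + 1) * Real.log (1 + n)) ≤ 6 * (1 + Real.log n) * d := by
  have hd' : (1 : ℝ) ≤ d := by exact_mod_cast hd
  have hn' : (1 : ℝ) ≤ n := by exact_mod_cast hn
  have hL : 0 ≤ Real.log n := Real.log_nonneg hn'
  have h1 : Real.log (1 + n) ≤ 1 + Real.log n := by
    have h2 : Real.log (1 + n) ≤ Real.log (2 * n) := Real.log_le_log (by linarith) (by linarith)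
    rw [Real.log_mul (by norm_num) (by linarith)] at h2
    linarith [Real.log_two_lt_d9]
  have h3 : ((d : ℝ) + 1) * Real.log (1 + n) ≤ (d + 1) * (1 + Real.log n) := by gcongr
  nlinarith [mul_nonneg (sub_nonneg.2 hd') hL]

/-- With `m = n` grid cells, rounding costs at most a constant. -/
lemma dynRegret_surrogate_le_of_small {d n : ℕ} {α B G C : ℝ} {z : ℕ → Vec d}
    {l : ℕ → Vec d → ℝ} (hd : 1 ≤ d) (hn : 1 ≤ n) (hα : 0 < α) (hB : 1 ≤ B) (hG : 0 < G)
    (hz : ∀ j, z j ∈ box d B)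
    (hl : ∀ t ∈ Finset.Icc 1 n, ∀ x ∈ box d B, ‖boxGrad B (l t) x‖ ≤ G)
    {w : ℕ → Vec d} (hw : w ∈ comparators d n B C) (hC : C ≤ 1 / n) :
    dynRegret n (surrogateLoss α B G z l) (decision α B G z l) w
      ≤ 20 * (1 + Real.log n) * (d * (8 * G ^ 2 * B ^ 2 * α * d + 1 / α)) := by
  have hd' : (1 : ℝ) ≤ d := by exact_mod_cast hd
  have hn' : (1 : ℝ) ≤ n := by exact_mod_cast hn
  have hL : 0 ≤ Real.log n := Real.log_nonneg hn'
  have h1 := dynRegret_surrogate_le hd hn hα hB hG hz hl hw hn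
  have h2 := adaptive_bound_le hd hn
  have hγ := gam_sq_le d hα B G
  set γ2 := gam d α B G ^ 2 with hγ2
  have hγ0 : 0 ≤ γ2 := sq_nonneg _
  have h3 : (n : ℝ) * C ≤ 1 := by
    rw [le_div_iff₀ (by linarith)] at hC
    linarith
  have h4 : γ2 * n / (n : ℝ) ^ 2 ≤ γ2 := by
    rw [div_le_iff₀ (by positivity)]
    have : (n : ℝ) ≤ n ^ 2 := by nlinarith
    gcongr
  have h5 : 0 ≤ 2 * (1 + ((d : ℝ) + 1) * Real.log (1 + n)) := by
    have : 0 ≤ Real.log (1 + (n : ℝ)) := Real.log_nonneg (by linarith)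
    positivity
  have h6 : 1 ≤ (1 + Real.log n) * d := by nlinarith
  calc _ ≤ _ := h1
    _ = γ2 * (2 * (1 + ((d : ℝ) + 1) * Real.log (1 + n))) * (1 + n * C)
          + γ2 * n / (n : ℝ) ^ 2 := by ring
    _ ≤ γ2 * (6 * (1 + Real.log n) * d) * (1 + 1) + γ2 * ((1 + Real.log n) * d) := by
      have h7 : γ2 ≤ γ2 * ((1 + Real.log n) * d) := le_mul_of_one_le_right hγ0 h6
      have h8 : γ2 * (2 * (1 + ((d : ℝ) + 1) * Real.log (1 + n))) * (1 + n * C)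
          ≤ γ2 * (2 * (1 + ((d : ℝ) + 1) * Real.log (1 + n))) * (1 + 1) := by gcongr
      have h9 : γ2 * (2 * (1 + ((d : ℝ) + 1) * Real.log (1 + n))) * (1 + 1)
          ≤ γ2 * (6 * (1 + Real.log n) * d) * (1 + 1) := by gcongr
      linarith
    _ = 13 * (1 + Real.log n) * (d * γ2) := by ring
    _ ≤ 20 * (1 + Real.log n) * (d * (8 * G ^ 2 * B ^ 2 * α * d + 1 / α)) := by
      gcongr
      norm_num

/-- The number `m` of grid cells is about `(n / C)^(1/3)`, which balances the number `m C` of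
switches against the rounding cost `n / m²`. -/
lemma dynRegret_surrogate_le_of_large {d n : ℕ} {α B G C : ℝ} {z : ℕ → Vec d}
    {l : ℕ → Vec d → ℝ} (hd : 1 ≤ d) (hn : 1 ≤ n) (hα : 0 < α) (hB : 1 ≤ B) (hG : 0 < G)
    (hz : ∀ j, z j ∈ box d B)
    (hl : ∀ t ∈ Finset.Icc 1 n, ∀ x ∈ box d B, ‖boxGrad B (l t) x‖ ≤ G)
    {w : ℕ → Vec d} (hw : w ∈ comparators d n B C) (hC : 0 < C) :
    dynRegret n (surrogateLoss α B G z l) (decision α B G z l) w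
      ≤ 20 * (1 + Real.log n) * (d * (8 * G ^ 2 * B ^ 2 * α * d + 1 / α)
        * max ((n : ℝ) ^ (1 / 3 : ℝ) * C ^ (2 / 3 : ℝ)) 1) := by
  have hd' : (1 : ℝ) ≤ d := by exact_mod_cast hd
  have hn' : (1 : ℝ) ≤ n := by exact_mod_cast hn
  have hn0 : (0 : ℝ) < n := by linarith
  have hL : 0 ≤ Real.log n := Real.log_nonneg hn'
  have h6 : 1 ≤ (1 + Real.log n) * d := by nlinarith
  set X := (n : ℝ) ^ (1 / 3 : ℝ) * C ^ (2 / 3 : ℝ) with hX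
  have hX0 : 0 < X := by positivity
  have hγ := gam_sq_le d hα B G
  set Γ := 8 * G ^ 2 * B ^ 2 * α * d + 1 / α with hΓ
  rcases le_or_gt C n with hCn | hCn
  · set p := ((n : ℝ) / C) ^ (1 / 3 : ℝ) with hp
    have hp1 : 1 ≤ p := Real.one_le_rpow ((one_le_div hC).2 hCn) (by norm_num)
    have hp0 : 0 < p := by linarith
    have hp3 : p ^ 3 = n / C := by
      rw [hp, ← Real.rpow_natCast, ← Real.rpow_mul (by positivity)]
      norm_num
    have hpX : C * p = X := by
      have : C = C ^ (1 / 3 : ℝ) * C ^ (2 / 3 : ℝ) := by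
        rw [← Real.rpow_add hC]; norm_num
      rw [hp, Real.div_rpow hn0.le hC.le, hX]
      nth_rewrite 1 [this]
      field_simp
    have hnp : n / p ^ 2 = X := by
      rw [← hpX, div_eq_iff (by positivity)]
      have h := (eq_div_iff hC.ne').1 hp3
      linear_combination -h
    set m := ⌈p⌉₊ with hm
    have hmp : p ≤ m := Nat.le_ceil p
    have hm2 : (m : ℝ) ≤ 2 * p := by
      linarith [Nat.ceil_lt_add_one hp0.le]
    have hm0 : 0 < m := Nat.ceil_pos.2 hp0
    have h1 := dynRegret_surrogate_le hd hn hα hB hG hz hl hw hm0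
    have h2 := adaptive_bound_le hd hn
    set γ2 := gam d α B G ^ 2
    have hγ0 : 0 ≤ γ2 := sq_nonneg _
    have h3 : (m : ℝ) * C ≤ 2 * X := by
      rw [← hpX]; nlinarith
    have h4 : γ2 * n / (m : ℝ) ^ 2 ≤ γ2 * X := by
      rw [← hnp, ← mul_div_assoc]
      gcongr
    have h5 : X ≤ max X 1 := le_max_left _ _
    have h7 : 1 ≤ max X 1 := le_max_right _ _
    calc _ ≤ _ := h1
      _ = γ2 * (2 * (1 + ((d : ℝ) + 1) * Real.log (1 + n))) * (1 + m * C)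
            + γ2 * n / (m : ℝ) ^ 2 := by ring
      _ ≤ γ2 * (6 * (1 + Real.log n) * d) * (3 * max X 1)
            + γ2 * ((1 + Real.log n) * d) * max X 1 := by
        refine add_le_add ?_ ?_
        · gcongr
          linarith
        · refine h4.trans ?_
          have : γ2 ≤ γ2 * ((1 + Real.log n) * d) := le_mul_of_one_le_right hγ0 h6
          gcongr
      _ = 19 * (1 + Real.log n) * (d * γ2 * max X 1) := by ring
      _ ≤ _ := by
        gcongr
        norm_num
  · have hXn : (n : ℝ) ≤ X := by
      have h1 : (n : ℝ) = (n : ℝ) ^ (1 / 3 : ℝ) * (n : ℝ) ^ (2 / 3 : ℝ) := by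
        rw [← Real.rpow_add hn0]; norm_num
      have h2 : (n : ℝ) ^ (2 / 3 : ℝ) ≤ C ^ (2 / 3 : ℝ) :=
        Real.rpow_le_rpow hn0.le hCn.le (by norm_num)
      rw [h1, hX]
      gcongr
    have hαΓ : 1 / α ≤ Γ := by
      have : 0 ≤ 8 * G ^ 2 * B ^ 2 * α * d := by positivity
      linarith
    have hΓ0 : 0 ≤ Γ := le_trans (by positivity) hαΓ
    calc _ ≤ n * (1 / α) := dynRegret_surrogate_le_trivial hα w
      _ ≤ max X 1 * Γ := by
        have := le_max_left X 1
        gcongr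
        linarith
      _ ≤ (20 * ((1 + Real.log n) * d)) * (max X 1 * Γ) := by
        apply le_mul_of_one_le_left (by positivity)
        linarith
      _ = _ := by ring

end FLHONS

theorem mainTheorem4 :
    ∃ (K : ℝ) (k : ℕ), 0 < K ∧
      ∀ (d n : ℕ) (α B G Ginf C : ℝ) (l : ℕ → FLHONS.Vec d → ℝ) (z : ℕ → FLHONS.Vec d),
        1 ≤ d → 1 ≤ n → 0 < α → 1 ≤ B → 1 ≤ G → 1 ≤ Ginf →
        (∀ t ∈ Finset.Icc 1 n, DifferentiableOn ℝ (l t) (FLHONS.box d B)) →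
        (∀ t ∈ Finset.Icc 1 n, FLHONS.ExpConcaveOnBox B α (l t)) →
        (∀ t ∈ Finset.Icc 1 n, ∀ x ∈ FLHONS.box d B,
          ‖FLHONS.boxGrad B (l t) x‖ ≤ G ∧ ∀ i, |FLHONS.boxGrad B (l t) x i| ≤ Ginf) →
        (∀ j, z j ∈ FLHONS.box d B) →
        (∀ t ∈ Finset.Icc 1 n, FLHONS.decision α B G z l t ∈ FLHONS.box d B) ∧
        FLHONS.worstRegret n B C l (FLHONS.decision α B G z l) ≤
          FLHONS.worstRegret n B C (FLHONS.surrogateLoss α B G z l)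
            (FLHONS.decision α B G z l) ∧
        (1 / (n : ℝ) < C →
          FLHONS.worstRegret n B C (FLHONS.surrogateLoss α B G z l)
              (FLHONS.decision α B G z l) ≤
            ((K * (1 + Real.log n) ^ k *
              ((d : ℝ) ^ 2 * (8 * G ^ 2 * B ^ 2 * α * d + G ^ 2 * B ^ 2 + 1 / α) *
                max ((n : ℝ) ^ (1 / 3 : ℝ) * C ^ (2 / 3 : ℝ)) 1) : ℝ) : EReal)) ∧
        (C ≤ 1 / (n : ℝ) →
          FLHONS.worstRegret n B C (FLHONS.surrogateLoss α B G z l)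
              (FLHONS.decision α B G z l) ≤
            ((K * (1 + Real.log n) ^ k *
              ((d : ℝ) * (8 * G ^ 2 * B ^ 2 * α * d + 1 / α)) : ℝ) : EReal)) := by
  refine ⟨20, 1, by norm_num, ?_⟩
  intro d n α B G Ginf C l z hd hn hα hB hG _ _ hexp hgrad hz
  have hG0 : 0 < G := by linarith
  have hl : ∀ t ∈ Finset.Icc 1 n, ∀ x ∈ FLHONS.box d B, ‖FLHONS.boxGrad B (l t) x‖ ≤ G :=
    fun t ht x hx => (hgrad t ht x hx).1
  have hx : ∀ t ∈ Finset.Icc 1 n, FLHONS.decision α B G z l t ∈ FLHONS.box d B :=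
    fun t ht => FLHONS.decision_mem_box hz (Finset.mem_Icc.1 ht).1
  have hn0 : (0 : ℝ) < n := by exact_mod_cast hn
  have hd1 : (1 : ℝ) ≤ d := by exact_mod_cast hd
  have hL : 0 ≤ Real.log n := Real.log_nonneg (by exact_mod_cast hn)
  refine ⟨hx, ?_, fun hC => ?_, fun hC => ?_⟩
  · refine iSup₂_mono fun w hw => EReal.coe_le_coe_iff.2 ?_
    exact Finset.sum_le_sum fun t ht =>
      FLHONS.loss_sub_le_surrogate_sub hα (hexp t ht) (hx t ht) (hw.1 t ht)
  · refine iSup₂_le fun w hw => EReal.coe_le_coe_iff.2 ?_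
    have hC0 : 0 < C := lt_trans (by positivity) hC
    refine (FLHONS.dynRegret_surrogate_le_of_large hd hn hα hB hG0 hz hl hw hC0).trans ?_
    rw [pow_one]
    have h1 : (d : ℝ) ≤ (d : ℝ) ^ 2 := by nlinarith
    have h2 : 8 * G ^ 2 * B ^ 2 * α * d + 1 / α
        ≤ 8 * G ^ 2 * B ^ 2 * α * d + G ^ 2 * B ^ 2 + 1 / α := by
      have : 0 ≤ G ^ 2 * B ^ 2 := by positivity
      linarith
    gcongr
  · refine iSup₂_le fun w hw => EReal.coe_le_coe_iff.2 ?_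
    rw [pow_one]
    exact FLHONS.dynRegret_surrogate_le_of_small hd hn hα hB hG0 hz hl hw hC
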